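/- Let $n\ge 1$ be an integer and let $\psi$ be a non-increasing function from the positive integers to the positive real numbers such that $\psi(s)=o\bigl(s^{-\frac{n+1}{n}}\bigr)$ as $s\to\infty$. Equip $\mathbb{R}^n$ with the norm $\|x\|=\max_{1\le i\le n}|x_i|$. For a positive function $\phi$ on the positive integers let \[ W(\phi)=\Bigl\{x\in\mathbb{R}^n \;:\; \text{there are infinitely many rational points } \tfrac{p}{q}\in\mathbb{Q}^n\ (p\in\mathbb{Z}^n,\ q\ge 1) \text{ with } \bigl\|x-\tfrac{p}{q}\bigr\|<\phi(q)\Bigr\} \] be the set of $\phi$-approximable points, and let \[ \mathbf{Bad}(\psi)=W(\psi)\setminus\bigcap_{c>0}W(c\psi) \] be the set of $\psi$-badly approximable points, where $c$ ranges over all positive real numbers. Then \[ \dim_H \mathbf{Bad}(\psi)=\dim_H W(\psi), \] where $\dim_H$ denotes Hausdorff dimension. -/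

import Mathlib

/-- The set `W(ψ)` of `ψ`-approximable points of `ℝⁿ`: those `x` for which there are infinitely many
rational points `v = p / q ∈ ℚⁿ` with `‖x - p / q‖ < ψ q`. The norm of `Fin n → ℝ` is the maximum
norm. Distinct fractions `p / q` representing the same rational point are counted once; when `ψ` is
non-increasing on the positive integers it makes no difference whether `p / q` is required to be in
lowest terms. -/
def approximableSet (n : ℕ) (ψ : ℕ → ℝ) : Set (Fin n → ℝ) :=
  {x | {v : Fin n → ℚ | ∃ (q : ℕ) (p : Fin n → ℤ), 1 ≤ q ∧ (∀ i, v i = (p i : ℚ) / (q : ℚ)) ∧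
    ‖x - fun i => (p i : ℝ) / (q : ℝ)‖ < ψ q}.Infinite}

/-- The set `Bad(ψ) = W(ψ) \ ⋂_{c > 0} W(cψ)` of `ψ`-badly approximable points of `ℝⁿ`. -/
def badlyApproximableSet (n : ℕ) (ψ : ℕ → ℝ) : Set (Fin n → ℝ) :=
  approximableSet n ψ \ ⋂ (c : ℝ) (_ : 0 < c), approximableSet n (fun q => c * ψ q)

open Filter Topology MeasureTheory Set
open scoped ENNReal NNReal Nat

/-! One inequality is the inclusion of Bad(ψ) in W(ψ). For the other, let s < s₁ < dim W(ψ). The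
obvious covering of W(ψ) by balls about rational points shows that ψ(Q) > Q^(-(n+1)/s₁) for
infinitely many Q (`dimH_approximableSet_le`), and this drives a Cantor construction of dimension at
least s inside Bad(ψ).

Most levels follow the classical construction of badly approximable points. By the simplex lemma
(`exists_hyperplane`) the rational points of small denominator near a cube lie on one hyperplane, so
the cube has `L ^ n` subcubes, smaller by the factor 20nL, that keep away from it
(`exists_children`). As L grows this loses arbitrarily little dimension. Distances of order
q^(-(n+1)/n) from p/q dominate c'ψ(q), since ψ(q) = o(q^(-(n+1)/n)).

For a sparse sequence of the Q above, when the radius has come down to about Q^(-(n+1)/n), every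
cube is replaced by one of radius ψ(Q)/4 at distance ψ(Q)/2 from a rational point p/q
(`exists_jump`). Its points are ψ-approximated by p/q, but not too well. Other rational points must
not interfere: Dirichlet's theorem at a badly approximable point gives q comparable to Q, and p/q is
isolated, because a close neighbour p'/q' would combine with it into a too good approximation
(`exists_isolated_approx`).

Before a jump a cube has mass about Q^(-σ(n+1)/n) with σ near n; this is at most ψ(Q)^s when s/s₁ <
σ/n and Q is large in terms of the previous jump. The mass distribution principle
(`le_dimH_of_tree`) concludes. -/

/-- The rational point `p / q` of `ℝⁿ`. -/
noncomputable def ratPt {n : ℕ} (p : Fin n → ℤ) (q : ℕ) : Fin n → ℝ := fun i => (p i : ℝ) / (q : ℝ)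

/-! ### The simplex lemma -/

/-- Rational points with small denominators in a small cube have vanishing determinant. -/
theorem det_ratPt_eq_zero {n : ℕ} (x₀ : Fin n → ℝ) {R t : ℝ} (hR : 0 < R)
    (ht : t * ((n + 1)! * R ^ n) ≤ 1) (p : Fin (n + 1) → Fin n → ℤ) (q : Fin (n + 1) → ℕ)
    (hq : ∀ j, 1 ≤ q j) (hqt : ∀ j, (q j : ℝ) ^ (n + 1) < t)
    (hv : ∀ j, ‖ratPt (p j) (q j) - x₀‖ ≤ R) :
    (Matrix.of fun j => (Fin.cons R (ratPt (p j) (q j) - x₀) : Fin (n + 1) → ℝ)).det = 0 := by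
  set A : Matrix (Fin (n + 1)) (Fin (n + 1)) ℝ :=
    Matrix.of fun j => (Fin.cons R (ratPt (p j) (q j) - x₀) : Fin (n + 1) → ℝ) with hA
  set Z : Matrix (Fin (n + 1)) (Fin (n + 1)) ℤ :=
    Matrix.of fun j => (Fin.cons (q j : ℤ) (p j) : Fin (n + 1) → ℤ) with hZ
  set w : Fin (n + 1) → ℝ := Fin.cons R (fun _ => 1) with hw
  set B : Matrix (Fin (n + 1)) (Fin (n + 1)) ℝ :=
    Matrix.of fun j => (Fin.cons R (ratPt (p j) (q j)) : Fin (n + 1) → ℝ) with hB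
  have hq0 : ∀ j, (0 : ℝ) < q j := fun j => by exact_mod_cast hq j
  -- Multiples of the constant first column remove `x₀`. That column is `R` rather than 1 so that
  -- `R` bounds every entry of `A` sharply enough.
  have hAB : A.det = B.det := by
    rw [← Matrix.det_transpose A, ← Matrix.det_transpose B]
    refine Matrix.det_eq_of_forall_row_eq_smul_add_const (Fin.cons 0 (fun i => -x₀ i / R)) 0 rfl ?_
    intro i j
    refine Fin.cases ?_ (fun i => ?_) i
    · simp [hA, hB]
    · simp [hA, hB]
      field_simp
      ring
  have hBZ : B.det = (∏ j, (q j : ℝ)⁻¹) * (R * (Z.det : ℝ)) := by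
    have h1 : B = Matrix.of fun i j => (q i : ℝ)⁻¹ *
        (Matrix.of fun i j => w j * (Z.map (Int.cast : ℤ → ℝ)) i j) i j := by
      ext i j
      have := hq0 i
      refine Fin.cases ?_ (fun j => ?_) j
      · simp [hB, hw, hZ]; field_simp
      · simp [hB, hw, hZ, ratPt]; field_simp
    have h2 : (Z.det : ℝ) = (Z.map (Int.cast : ℤ → ℝ)).det := by
      simpa using (Int.castRingHom ℝ).map_det Z
    rw [h1, Matrix.det_mul_column, Matrix.det_mul_row, h2]
    simp [hw, Fin.prod_univ_succ]
  have hle : |A.det| ≤ (n + 1)! * R ^ (n + 1) := by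
    have := Matrix.det_le (A := A) (abv := AbsoluteValue.abs) (x := R) (fun i j => by
      refine Fin.cases ?_ (fun j => ?_) j
      · simp [hA, abs_of_pos hR]
      · have := norm_le_pi_norm (ratPt (p i) (q i) - x₀) j
        simpa [hA] using this.trans (hv i))
    simpa using this
  have hprod : ∏ j, (q j : ℝ) < t := by
    have hp0 : 0 < ∏ j, (q j : ℝ) := Finset.prod_pos fun j _ => hq0 j
    have ht0 : 0 < t := (pow_pos (hq0 0) _).trans (hqt 0)
    have : (∏ j, (q j : ℝ)) ^ (n + 1) < t ^ (n + 1) := by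
      rw [← Finset.prod_pow]
      calc ∏ j, (q j : ℝ) ^ (n + 1) < ∏ _j : Fin (n + 1), t :=
            Finset.prod_lt_prod_of_nonempty (fun j _ => pow_pos (hq0 j) _) (fun j _ => hqt j)
              ⟨0, Finset.mem_univ _⟩
        _ = t ^ (n + 1) := by simp
    exact lt_of_pow_lt_pow_left₀ _ ht0.le this
  -- A nonzero integer determinant has modulus at least 1, so the two bounds would give `R < R`.
  by_contra hne
  have hZ0 : Z.det ≠ 0 := by
    intro h; apply hne; rw [hAB, hBZ, h]; simp
  have hZ1 : (1 : ℝ) ≤ |(Z.det : ℝ)| := by exact_mod_cast Int.one_le_abs hZ0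
  have hp0 : 0 < ∏ j, (q j : ℝ) := Finset.prod_pos fun j _ => hq0 j
  rw [hAB, hBZ, Finset.prod_inv_distrib, abs_mul, abs_mul, abs_of_pos (inv_pos.2 hp0),
    abs_of_pos hR] at hle
  have h3 : R * |(Z.det : ℝ)| ≤ (∏ j, (q j : ℝ)) * ((n + 1)! * R ^ (n + 1)) := by
    rwa [inv_mul_le_iff₀ hp0] at hle
  have h4 : (∏ j, (q j : ℝ)) * ((n + 1)! * R ^ (n + 1)) < t * ((n + 1)! * R ^ (n + 1)) :=
    mul_lt_mul_of_pos_right hprod (by positivity)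
  have h5 : t * ((n + 1)! * R ^ (n + 1)) ≤ R := by
    calc t * ((n + 1)! * R ^ (n + 1)) = (t * ((n + 1)! * R ^ n)) * R := by ring
      _ ≤ 1 * R := by gcongr
      _ = R := one_mul R
  nlinarith [mul_le_mul_of_nonneg_left hZ1 hR.le]

/-- **Simplex lemma**: the rational points with small denominators in a small cube lie on an affine
hyperplane. -/
theorem exists_hyperplane {n : ℕ} (hn : 1 ≤ n) (x₀ : Fin n → ℝ) {R t : ℝ} (hR : 0 < R)
    (ht : t * ((n + 1)! * R ^ n) ≤ 1) (S : Set (Fin n → ℝ))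
    (hS : ∀ v ∈ S, ‖v - x₀‖ ≤ R ∧ ∃ (p : Fin n → ℤ) (q : ℕ), 1 ≤ q ∧ (q : ℝ) ^ (n + 1) < t ∧
      v = ratPt p q) :
    ∃ (a : Fin n → ℝ) (a₀ : ℝ) (i₀ : Fin n), |a i₀| = 1 ∧ (∀ i, |a i| ≤ 1) ∧
      ∀ v ∈ S, ∑ i, a i * v i = a₀ := by
  have : Nonempty (Fin n) := ⟨⟨0, hn⟩⟩
  rcases S.eq_empty_or_nonempty with rfl | ⟨v₀, hv₀⟩
  · exact ⟨fun _ => 1, 0, ⟨0, hn⟩, by simp, by simp, by simp⟩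
  set u : (Fin n → ℝ) → (Fin (n + 1) → ℝ) := fun v => Fin.cons R (v - x₀) with hu
  -- If the vectors `(R, v - x₀)` spanned, a basis could be chosen among them, against the vanishing
  -- determinant. A functional killing them is the hyperplane.
  have hspan : Submodule.span ℝ (u '' S) < ⊤ := by
    rw [lt_top_iff_ne_top]
    intro htop
    obtain ⟨b, hbsub, hbspan, hbli⟩ := exists_linearIndependent ℝ (u '' S)
    let bas := Module.Basis.mk hbli (by rw [Subtype.range_coe, hbspan, htop])
    have hfin : Finite b := Module.Finite.finite_basis bas
    have := Fintype.ofFinite b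
    have hcard : Fintype.card b = Fintype.card (Fin (n + 1)) := by
      rw [← Module.finrank_eq_card_basis bas]; simp
    let e : Fin (n + 1) ≃ b := (Fintype.equivOfCardEq hcard).symm
    have hmem : ∀ j, ∃ v ∈ S, u v = e j := fun j => hbsub (e j).2
    choose f hfS hfu using hmem
    choose hfR p q hq hqt hpq using fun j => hS (f j) (hfS j)
    have hdet := det_ratPt_eq_zero x₀ hR ht p q hq hqt (fun j => by rw [← hpq]; exact hfR j)
    have hli : LinearIndependent ℝ (fun j => (e j : Fin (n + 1) → ℝ)) := hbli.comp e e.injective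
    have hrow : (Matrix.of fun j => (Fin.cons R (ratPt (p j) (q j) - x₀) : Fin (n + 1) → ℝ)).row
        = fun j => (e j : Fin (n + 1) → ℝ) := by
      funext j
      rw [← hfu j, hpq j]; rfl
    rw [← hrow, Matrix.linearIndependent_rows_iff_isUnit, Matrix.isUnit_iff_isUnit_det, hdet] at hli
    simp at hli
  obtain ⟨f, hf0, hf⟩ := Submodule.exists_le_ker_of_lt_top _ hspan
  set α : Fin (n + 1) → ℝ := fun j => f (Pi.single j 1) with hα
  have hfe : ∀ x, f x = ∑ j, α j * x j := by
    intro x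
    conv_lhs => rw [pi_eq_sum_univ' x]
    simp [hα, map_sum, mul_comm]
  have hker : ∀ v ∈ S, α 0 * R + ∑ i : Fin n, α i.succ * (v i - x₀ i) = 0 := by
    intro v hv
    have : f (u v) = 0 := hf (Submodule.subset_span ⟨v, hv, rfl⟩)
    rw [hfe, Fin.sum_univ_succ] at this
    simpa [hu] using this
  obtain ⟨i₀, hi₀⟩ := Finite.exists_max (fun i : Fin n => |α i.succ|)
  have hpos : 0 < |α i₀.succ| := by
    rw [abs_pos]
    intro h0
    have hz : ∀ i : Fin n, α i.succ = 0 := fun i => by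
      have := hi₀ i
      simpa [h0] using this
    have h1 := hker v₀ hv₀
    simp only [hz, zero_mul, Finset.sum_const_zero, add_zero, mul_eq_zero, hR.ne', or_false] at h1
    apply hf0
    ext x
    simp only [LinearMap.comp_apply, LinearMap.zero_apply]
    rw [hfe, Fin.sum_univ_succ]
    simp [h1, hz]
  -- After division by the largest coefficient, a shift along `i₀` changes the form by exactly its
  -- length.
  set m := |α i₀.succ|
  refine ⟨fun i => α i.succ / m, (∑ i : Fin n, α i.succ * x₀ i - α 0 * R) / m, i₀, ?_, ?_, ?_⟩
  · rw [abs_div, abs_of_pos hpos]; exact div_self hpos.ne'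
  · intro i
    rw [abs_div, abs_of_pos hpos]
    exact (div_le_one hpos).2 (hi₀ i)
  · intro v hv
    have h1 := hker v hv
    simp only [mul_sub, Finset.sum_sub_distrib] at h1
    simp only [div_mul_eq_mul_div, ← Finset.sum_div]
    congr 1
    linarith

/-! ### Subcubes avoiding rational points -/

theorem abs_sum_mul_sub_le {n : ℕ} {a : Fin n → ℝ} (ha : ∀ i, |a i| ≤ 1) (x y : Fin n → ℝ) :
    |∑ i, a i * x i - ∑ i, a i * y i| ≤ n * ‖x - y‖ := by
  rw [← Finset.sum_sub_distrib]
  refine (Finset.abs_sum_le_sum_abs _ _).trans ?_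
  calc ∑ i, |a i * x i - a i * y i| ≤ ∑ _i : Fin n, ‖x - y‖ := by
        refine Finset.sum_le_sum fun i _ => ?_
        rw [← mul_sub, abs_mul]
        have h1 : |x i - y i| ≤ ‖x - y‖ := by simpa using norm_le_pi_norm (x - y) i
        calc |a i| * |x i - y i| ≤ 1 * ‖x - y‖ := by gcongr; exact ha i
          _ = ‖x - y‖ := one_mul _
    _ = n * ‖x - y‖ := by simp

/-- Every cube of radius `ρ` contains `L ^ n` well separated cubes of radius `ρ / M` that avoid the
rational points with denominators in the range `θ ≤ q ^ (n + 1) * ρ ^ n < θ * M ^ n`. -/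
theorem exists_children {n L : ℕ} (hn : 1 ≤ n) (hL : 1 ≤ L) {M θ : ℝ} (hM : M = 20 * n * L)
    (hθ : θ = 1 / (M ^ n * (2 ^ n * (n + 1)!))) (x₀ : Fin n → ℝ) {ρ : ℝ} (hρ : 0 < ρ) :
    ∃ F : (Fin n → Fin L) → Fin n → ℝ,
      (∀ i, ‖F i - x₀‖ + ρ / M ≤ ρ / 2) ∧
      (∀ i j, i ≠ j → 4 * (ρ / M) ≤ ‖F i - F j‖) ∧
      ∀ i x, ‖x - F i‖ ≤ ρ / M → ∀ (p : Fin n → ℤ) (q : ℕ), 1 ≤ q →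
        (q : ℝ) ^ (n + 1) * (ρ / M) ^ n < θ → θ ≤ (q : ℝ) ^ (n + 1) * ρ ^ n →
        θ / M ^ n ≤ (q : ℝ) ^ (n + 1) * ‖x - ratPt p q‖ ^ n := by
  have hn' : (1 : ℝ) ≤ n := by exact_mod_cast hn
  have hL' : (1 : ℝ) ≤ L := by exact_mod_cast hL
  have hM20 : 20 ≤ M := by rw [hM]; nlinarith
  have hM0 : 0 < M := by linarith
  have hθ0 : 0 < θ := by rw [hθ]; positivity
  set h := ρ / M with hh
  have hh0 : 0 < h := by positivity
  have hρh : ρ = M * h := by rw [hh]; field_simp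
  set S : Set (Fin n → ℝ) := {v | ‖v - x₀‖ ≤ 2 * ρ ∧ ∃ (p : Fin n → ℤ) (q : ℕ), 1 ≤ q ∧
    (q : ℝ) ^ (n + 1) < θ / h ^ n ∧ v = ratPt p q} with hS
  -- The value of `θ` turns the volume condition into an equality.
  obtain ⟨a, a₀, i₀, hai, ha, haS⟩ := exists_hyperplane hn x₀ (R := 2 * ρ) (t := θ / h ^ n)
    (by positivity) (by
      have : M ^ n ≠ 0 := by positivity
      have : h ^ n ≠ 0 := by positivity
      rw [hθ, hρh, mul_pow, mul_pow]
      apply le_of_eq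
      field_simp) S (fun v hv => hv)
  set ℓ : (Fin n → ℝ) → ℝ := fun x => ∑ i, a i * x i with hℓ
  -- Spacing `10 * n * h` leaves room for a shift by `5 * n * h`, and the grid fits because `ρ / 2 =
  -- 10 * n * L * h`.
  set base : (Fin n → Fin L) → Fin n → ℝ := fun i k => x₀ k + 10 * n * h * (i k : ℝ) with hbase
  set sh : (Fin n → Fin L) → Fin n → ℝ := fun i => base i + Pi.single i₀ (5 * n * h) with hsh
  classical
  -- The shift changes `ℓ` by `5 * n * h`, so one of the two positions has `|ℓ - a₀|` at least half
  -- of that. A hyperplane point within `2 * h` would give at most `2 * n * h`.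
  set F : (Fin n → Fin L) → Fin n → ℝ := fun i =>
    if 5 / 2 * n * h ≤ |ℓ (base i) - a₀| then base i else sh i with hF
  have hFℓ : ∀ i, 5 / 2 * n * h ≤ |ℓ (F i) - a₀| := by
    intro i
    by_cases hc : 5 / 2 * n * h ≤ |ℓ (base i) - a₀|
    · simp [hF, hc]
    · have h1 : ℓ (sh i) = ℓ (base i) + a i₀ * (5 * n * h) := by
        simp only [hℓ, hsh, Pi.add_apply, mul_add, Finset.sum_add_distrib]
        congr 1
        rw [Finset.sum_eq_single i₀]
        · simp
        · intro b _ hb; simp [hb]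
        · simp
      have h2 : |a i₀ * (5 * n * h)| = 5 * n * h := by
        rw [abs_mul, hai, one_mul, abs_of_nonneg (by positivity)]
      have h3 : F i = sh i := by simp [hF, hc]
      rw [h3, h1]
      have h4 : |a i₀ * (5 * n * h)| ≤ |ℓ (base i) + a i₀ * (5 * n * h) - a₀| + |ℓ (base i) - a₀| := by
        have := abs_sub (ℓ (base i) + a i₀ * (5 * n * h) - a₀) (ℓ (base i) - a₀)
        simpa using this
      push Not at hc
      linarith
  have hFk : ∀ i k, base i k ≤ F i k ∧ F i k ≤ base i k + 5 * n * h := by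
    intro i k
    have h5 : 0 ≤ 5 * n * h := by positivity
    by_cases hc : 5 / 2 * n * h ≤ |ℓ (base i) - a₀|
    · have h3 : F i = base i := by simp [hF, hc]
      rw [h3]; constructor <;> linarith
    · have h3 : F i = sh i := by simp [hF, hc]
      rw [h3]
      by_cases hk : k = i₀
      · subst hk; simp [hsh]; positivity
      · simp [hsh, hk]; positivity
  have hin : ∀ i, ‖F i - x₀‖ + h ≤ ρ / 2 := by
    intro i
    have : ‖F i - x₀‖ ≤ 10 * n * h * (L - 1) + 5 * n * h := by
      rw [pi_norm_le_iff_of_nonneg (by have : 0 ≤ (L : ℝ) - 1 := by linarith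
                                       positivity)]
      intro k
      obtain ⟨h1, h2⟩ := hFk i k
      have h3 : (0 : ℝ) ≤ (i k : ℝ) := by positivity
      have h4 : (i k : ℝ) ≤ L - 1 := by
        have : (i k : ℕ) + 1 ≤ L := (i k).2
        have : ((i k : ℕ) : ℝ) + 1 ≤ L := by exact_mod_cast this
        linarith
      simp only [hbase] at h1 h2
      have h5 : 0 ≤ 10 * n * h * (i k : ℝ) := by positivity
      have h6 : 10 * n * h * (i k : ℝ) ≤ 10 * n * h * (L - 1) := by gcongr
      rw [Pi.sub_apply, Real.norm_eq_abs, abs_le]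
      constructor <;> linarith
    have h7 : h ≤ n * h := by nlinarith
    rw [hρh, hM]
    nlinarith
  refine ⟨F, hin, ?_, ?_⟩
  · intro i j hij
    obtain ⟨k, hk⟩ := Function.ne_iff.1 hij
    refine le_trans ?_ (norm_le_pi_norm (F i - F j) k)
    obtain ⟨h1, h2⟩ := hFk i k
    obtain ⟨h3, h4⟩ := hFk j k
    simp only [hbase] at h1 h2 h3 h4
    have h7 : h ≤ n * h := by nlinarith
    have h8 : 0 ≤ 10 * n * h := by positivity
    rw [Pi.sub_apply, Real.norm_eq_abs, le_abs]
    rcases lt_or_gt_of_ne hk with hlt | hlt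
    · right
      have : (i k : ℝ) + 1 ≤ (j k : ℝ) := by exact_mod_cast (hlt : (i k : ℕ) < j k)
      have := mul_le_mul_of_nonneg_left this h8
      linarith
    · left
      have : (j k : ℝ) + 1 ≤ (i k : ℝ) := by exact_mod_cast (hlt : (j k : ℕ) < i k)
      have := mul_le_mul_of_nonneg_left this h8
      linarith
  · intro i x hx p q hq hqh hqρ
    by_contra hlt
    push Not at hlt
    have hq0 : (0 : ℝ) < q := by exact_mod_cast hq
    have h1 : ‖x - ratPt p q‖ < h := by
      refine lt_of_pow_lt_pow_left₀ n hh0.le ?_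
      have h2 : θ / M ^ n ≤ (q : ℝ) ^ (n + 1) * h ^ n := by
        rw [hh, div_pow, ← mul_div_assoc]; gcongr
      exact lt_of_mul_lt_mul_left (hlt.trans_le h2) (by positivity)
    have h2 : ‖F i - ratPt p q‖ ≤ 2 * h := by
      calc ‖F i - ratPt p q‖ = ‖(x - ratPt p q) - (x - F i)‖ := by congr 1; abel
        _ ≤ ‖x - ratPt p q‖ + ‖x - F i‖ := norm_sub_le _ _
        _ ≤ 2 * h := by linarith
    have h3 : ratPt p q ∈ S := by
      refine ⟨?_, p, q, hq, ?_, rfl⟩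
      · have := hin i
        have h4 : 2 * h ≤ ρ := by rw [hρh]; nlinarith
        calc ‖ratPt p q - x₀‖ = ‖(F i - x₀) - (F i - ratPt p q)‖ := by congr 1; abel
          _ ≤ ‖F i - x₀‖ + ‖F i - ratPt p q‖ := norm_sub_le _ _
          _ ≤ 2 * ρ := by linarith
      · rwa [lt_div_iff₀ (by positivity)]
    have h4 := hFℓ i
    rw [← haS _ h3] at h4
    have h5 := abs_sum_mul_sub_le ha (F i) (ratPt p q)
    have h6 : (n : ℝ) * ‖F i - ratPt p q‖ ≤ n * (2 * h) := by gcongr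
    have h7 : 0 < n * h := by positivity
    simp only [hℓ] at h4
    linarith

/-- Every cube contains a point, near its centre, that is badly approximable by rational points with
denominators in a given range. -/
theorem exists_bad_point {n L : ℕ} (hn : 1 ≤ n) (hL : 1 ≤ L) {M θ : ℝ} (hM : M = 20 * n * L)
    (hθ : θ = 1 / (M ^ n * (2 ^ n * (n + 1)!))) (x₀ : Fin n → ℝ) {ρ : ℝ} (hρ : 0 < ρ) (Q : ℕ) :
    ∃ y, ‖y - x₀‖ ≤ ρ / 2 ∧ ∀ (p : Fin n → ℤ) (q : ℕ), 1 ≤ q → q ≤ Q →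
        θ ≤ (q : ℝ) ^ (n + 1) * ρ ^ n → θ / M ^ n ≤ (q : ℝ) ^ (n + 1) * ‖y - ratPt p q‖ ^ n := by
  have hn' : (1 : ℝ) ≤ n := by exact_mod_cast hn
  have hL' : (1 : ℝ) ≤ L := by exact_mod_cast hL
  have hM20 : 20 ≤ M := by rw [hM]; nlinarith
  have hM0 : 0 < M := by linarith
  have hθ0 : 0 < θ := by rw [hθ]; positivity
  -- Following one child `k` times works because the windows of denominators of successive scales
  -- abut. For `k = 0` the window is empty.
  have key : ∀ k : ℕ, ∀ (x₀ : Fin n → ℝ) (ρ : ℝ), 0 < ρ → ∃ y, ‖y - x₀‖ ≤ ρ / 2 ∧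
      ∀ (p : Fin n → ℤ) (q : ℕ), 1 ≤ q → (q : ℝ) ^ (n + 1) * (ρ / M ^ k) ^ n < θ →
        θ ≤ (q : ℝ) ^ (n + 1) * ρ ^ n → θ / M ^ n ≤ (q : ℝ) ^ (n + 1) * ‖y - ratPt p q‖ ^ n := by
    intro k
    induction k with
    | zero =>
      intro x₀ ρ hρ
      refine ⟨x₀, by simp; positivity, fun p q _ h1 h2 => ?_⟩
      simp only [pow_zero, div_one] at h1
      exact absurd h1 (not_lt.2 h2)
    | succ k ih =>
      intro x₀ ρ hρ
      obtain ⟨F, hF1, -, hF3⟩ := exists_children hn hL hM hθ x₀ hρ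
      set i : Fin n → Fin L := fun _ => ⟨0, hL⟩
      obtain ⟨y, hy, hyb⟩ := ih (F i) (ρ / M) (by positivity)
      have hρM : 0 < ρ / M := by positivity
      refine ⟨y, ?_, fun p q hq h1 h2 => ?_⟩
      · have := hF1 i
        calc ‖y - x₀‖ = ‖(y - F i) + (F i - x₀)‖ := by congr 1; abel
          _ ≤ ‖y - F i‖ + ‖F i - x₀‖ := norm_add_le _ _
          _ ≤ ρ / 2 := by linarith
      · by_cases h3 : (q : ℝ) ^ (n + 1) * (ρ / M) ^ n < θ
        · exact hF3 i y (by linarith) p q hq h3 h2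
        · refine hyb p q hq ?_ (not_lt.1 h3)
          rwa [div_div, ← pow_succ']
  obtain ⟨k, hk⟩ : ∃ k : ℕ, (Q : ℝ) ^ (n + 1) * (ρ / M ^ k) ^ n < θ := by
    have h1 : Tendsto (fun k : ℕ => (Q : ℝ) ^ (n + 1) * (ρ / M ^ k) ^ n) atTop
        (𝓝 ((Q : ℝ) ^ (n + 1) * 0 ^ n)) := by
      refine ((Tendsto.pow ?_ n).const_mul _)
      exact tendsto_const_nhds.div_atTop (tendsto_pow_atTop_atTop_of_one_lt (by linarith))
    rw [zero_pow (by omega), mul_zero] at h1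
    exact (h1.eventually (gt_mem_nhds hθ0)).exists
  obtain ⟨y, hy, hyb⟩ := key k x₀ ρ hρ
  refine ⟨y, hy, fun p q hq hqQ h => hyb p q hq (lt_of_le_of_lt ?_ hk) h⟩
  have : (q : ℝ) ≤ Q := by exact_mod_cast hqQ
  gcongr

/-! ### Dirichlet's theorem and isolated rational points -/

/-- **Dirichlet's theorem** on simultaneous approximation. -/
theorem exists_simultaneous_approx {n : ℕ} (y : Fin n → ℝ) {b : ℕ} (hb : 1 ≤ b) :
    ∃ (q : ℕ) (p : Fin n → ℤ), 1 ≤ q ∧ q ≤ b ^ n ∧ ‖(q : ℝ) • y - fun i => (p i : ℝ)‖ * b ≤ 1 := by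
  have hb0 : (0 : ℝ) < b := by exact_mod_cast hb
  -- Pigeonhole: `b ^ n + 1` multiples of `y` modulo 1 fall into `b ^ n` boxes of side `1 / b`.
  set f : ℕ → Fin n → Fin b := fun k i => ⟨⌊Int.fract ((k : ℝ) * y i) * b⌋₊, by
    rw [Nat.floor_lt (by have := Int.fract_nonneg ((k : ℝ) * y i); positivity)]
    have := Int.fract_lt_one ((k : ℝ) * y i)
    nlinarith⟩ with hf
  obtain ⟨k, hk, l, hl, hkl, hfe⟩ := Finset.exists_ne_map_eq_of_card_lt_of_maps_to
    (s := Finset.range (b ^ n + 1)) (t := (Finset.univ : Finset (Fin n → Fin b))) (f := f)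
    (by simp) (by intro x _; simp)
  wlog hlt : k < l generalizing k l
  · exact this l hl k hk hkl.symm hfe.symm (by omega)
  refine ⟨l - k, fun i => ⌊(l : ℝ) * y i⌋ - ⌊(k : ℝ) * y i⌋, by omega, ?_, ?_⟩
  · have := Finset.mem_range.1 hl
    omega
  · rw [← le_div_iff₀ hb0, pi_norm_le_iff_of_nonneg (by positivity)]
    intro i
    rw [le_div_iff₀ hb0]
    have h1 : ⌊Int.fract ((k : ℝ) * y i) * b⌋₊ = ⌊Int.fract ((l : ℝ) * y i) * b⌋₊ := by
      have := congr_fun hfe i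
      simpa [hf] using this
    have hk0 : 0 ≤ Int.fract ((k : ℝ) * y i) * b := by
      have := Int.fract_nonneg ((k : ℝ) * y i); positivity
    have hl0 : 0 ≤ Int.fract ((l : ℝ) * y i) * b := by
      have := Int.fract_nonneg ((l : ℝ) * y i); positivity
    have a1 := Nat.floor_le hk0
    have a2 := Nat.lt_floor_add_one (Int.fract ((k : ℝ) * y i) * b)
    have a3 := Nat.floor_le hl0
    have a4 := Nat.lt_floor_add_one (Int.fract ((l : ℝ) * y i) * b)
    rw [h1] at a1 a2
    have e : ((((l - k : ℕ) : ℝ) • y - fun i => ((⌊(l : ℝ) * y i⌋ - ⌊(k : ℝ) * y i⌋ : ℤ) : ℝ)) i)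
        = Int.fract ((l : ℝ) * y i) - Int.fract ((k : ℝ) * y i) := by
      simp only [Pi.sub_apply, Pi.smul_apply, smul_eq_mul, Int.fract]
      push_cast [hlt.le]
      ring
    have e' : ∀ r : ℝ, |r| * b = |r * b| := fun r => by rw [abs_mul, abs_of_pos hb0]
    rw [e, Real.norm_eq_abs, e', sub_mul, abs_le]
    constructor <;> linarith

theorem norm_smul_sub_intCast {n : ℕ} (y : Fin n → ℝ) (p : Fin n → ℤ) {q : ℕ} (hq : 1 ≤ q) :
    ‖(q : ℝ) • y - fun i => (p i : ℝ)‖ = q * ‖y - ratPt p q‖ := by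
  have hq0 : (0 : ℝ) < q := by exact_mod_cast hq
  have : (q : ℝ) • y - (fun i => (p i : ℝ)) = (q : ℝ) • (y - ratPt p q) := by
    ext i
    simp [ratPt]
    field_simp
  rw [this, norm_smul, Real.norm_eq_abs, abs_of_pos hq0]

/-- A badly approximable point is close to a rational point that is well separated from all other
rational points. -/
theorem exists_isolated_approx {n : ℕ} (hn : 1 ≤ n) {c d η : ℝ} {N b Q : ℕ} (hc1 : c ≤ 1)
    (hN : 1 ≤ N) (hd : 0 < d) (hNd : 2 / N + 2 * N * d < c) (hb : 1 ≤ b) (hbQ : b ^ n ≤ Q)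
    (hQb : (Q : ℝ) ≤ (2 * b) ^ n) (hη : 1 < b * η) (y : Fin n → ℝ)
    (hy : ∀ (p : Fin n → ℤ) (q : ℕ), 1 ≤ q → q ≤ Q →
      c ≤ (q : ℝ) ^ (n + 1) * ‖y - ratPt p q‖ ^ n ∨ η ≤ ‖y - ratPt p q‖) :
    ∃ (p : Fin n → ℤ) (q : ℕ), 1 ≤ q ∧ q ≤ Q ∧ ‖y - ratPt p q‖ * (b * q) ≤ 1 ∧
      (∀ (p' : Fin n → ℤ) (q' : ℕ), 1 ≤ q' → q' ≤ Q → ratPt p' q' = ratPt p q →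
        c * Q ≤ 2 ^ n * q') ∧
      ∀ (p' : Fin n → ℤ) (q' : ℕ), 1 ≤ q' → ratPt p' q' ≠ ratPt p q →
        d ≤ b * q' * ‖ratPt p q - ratPt p' q'‖ := by
  have hb0 : (0 : ℝ) < b := by exact_mod_cast hb
  have hb1 : (1 : ℝ) ≤ b := by exact_mod_cast hb
  have hN0 : (0 : ℝ) < N := by exact_mod_cast hN
  -- An approximation of Dirichlet quality, at distance at most `u / (b * q')`, cannot be of the
  -- kind `η ≤ ‖y - ratPt p' q'‖` since `b * η > 1`; badness of `y` then bounds `q'` below.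
  have key : ∀ (p' : Fin n → ℤ) (q' : ℕ) (u : ℝ), 1 ≤ q' → q' ≤ Q → u ≤ 1 →
      q' * ‖y - ratPt p' q'‖ * b ≤ u → c * Q ≤ (2 * u) ^ n * q' := by
    intro p' q' u hq' hq'Q hu h
    have hq0 : (0 : ℝ) < q' := by exact_mod_cast hq'
    have hq1 : (1 : ℝ) ≤ q' := by exact_mod_cast hq'
    have hnn := norm_nonneg (y - ratPt p' q')
    rcases hy p' q' hq' hq'Q with h1 | h1
    · have hc0 : 0 < c := lt_trans (by positivity) hNd
      calc c * Q ≤ ((q' : ℝ) ^ (n + 1) * ‖y - ratPt p' q'‖ ^ n) * (2 * b) ^ n := by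
            gcongr
        _ = (2 * (q' * ‖y - ratPt p' q'‖ * b)) ^ n * q' := by
            simp only [mul_pow]; ring
        _ ≤ (2 * u) ^ n * q' := by gcongr
    · exfalso
      have : b * η ≤ q' * ‖y - ratPt p' q'‖ * b := by
        calc b * η ≤ b * ‖y - ratPt p' q'‖ := by gcongr
          _ ≤ b * (q' * ‖y - ratPt p' q'‖) := by
            gcongr
            nlinarith
          _ = _ := by ring
      linarith
  obtain ⟨q, p, hq, hqb, hqp⟩ := exists_simultaneous_approx y hb
  have hqQ := hqb.trans hbQ
  have hq0 : (0 : ℝ) < q := by exact_mod_cast hq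
  rw [norm_smul_sub_intCast y p hq] at hqp
  refine ⟨p, q, hq, hqQ, by linarith, ?_, ?_⟩
  · intro p' q' hq' hq'Q he
    -- For `q' > q` the Dirichlet bound may fail for `q'`, but the lower bound on `q` is enough.
    by_cases hqq : q' ≤ q
    · have : (q' : ℝ) ≤ q := by exact_mod_cast hqq
      have := key p' q' 1 hq' hq'Q le_rfl (by rw [he]; exact le_trans (by gcongr) hqp)
      simpa using this
    · have : (q : ℝ) ≤ q' := by exact_mod_cast (not_le.1 hqq).le
      have h1 := key p q 1 hq hqQ le_rfl hqp
      rw [mul_one] at h1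
      exact h1.trans (by gcongr)
  · intro p' q' hq' hne
    by_contra hlt
    push Not at hlt
    have hq'0 : (0 : ℝ) < q' := by exact_mod_cast hq'
    -- As `q'` is unbounded, `(q', p')` is reduced by `(q, p)`: the combination `(Z, P)` has `|Z| ≤
    -- q / N` and approximates `y` within `c / 2` in Dirichlet's normalisation. If `Z = 0` then `P =
    -- 0` and the two points coincide; otherwise `key` is contradicted.
    obtain ⟨j, k, hk0, hkN, hjk⟩ := Real.exists_int_int_abs_mul_sub_le ((q' : ℝ) / q) hN
    have hk0' : (0 : ℝ) < k := by exact_mod_cast hk0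
    have hkN' : (k : ℝ) ≤ N := by exact_mod_cast hkN
    set Z : ℤ := k * q' - j * q with hZ
    set P : Fin n → ℤ := fun i => k * p' i - j * p i with hP
    have hZq : |(Z : ℝ)| * N ≤ q := by
      have e : (Z : ℝ) = q * (k * (q' / q) - j) := by
        rw [hZ]; push_cast; field_simp
      rw [e, abs_mul, abs_of_pos hq0]
      calc q * |k * ((q' : ℝ) / q) - j| * N ≤ q * (1 / (N + 1)) * N := by gcongr
        _ ≤ q := by
          rw [mul_assoc, div_mul_eq_mul_div, one_mul]
          have : (N : ℝ) / (N + 1) ≤ 1 := by rw [div_le_one (by positivity)]; linarith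
          nlinarith
    have hvec : (Z : ℝ) • y - (fun i => (P i : ℝ)) =
        (Z : ℝ) • (y - ratPt p q) + (k * q' : ℝ) • (ratPt p q - ratPt p' q') := by
      ext i
      simp only [hZ, hP, ratPt, Pi.sub_apply, Pi.add_apply, Pi.smul_apply, smul_eq_mul]
      push_cast
      field_simp
      ring
    have hkd : k * (b * q' * ‖ratPt p q - ratPt p' q'‖) ≤ N * d := by gcongr
    have hbound : ‖(Z : ℝ) • y - fun i => (P i : ℝ)‖ * b ≤ 1 / N + N * d := by
      rw [hvec]
      have h1 : |(Z : ℝ)| * ‖y - ratPt p q‖ * b ≤ 1 / N := by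
        rw [le_div_iff₀ hN0]
        calc |(Z : ℝ)| * ‖y - ratPt p q‖ * b * N = (|(Z : ℝ)| * N) * ‖y - ratPt p q‖ * b := by ring
          _ ≤ q * ‖y - ratPt p q‖ * b := by gcongr
          _ ≤ 1 := hqp
      calc _ ≤ (‖(Z : ℝ) • (y - ratPt p q)‖ + ‖(k * q' : ℝ) • (ratPt p q - ratPt p' q')‖) * b := by
            gcongr; exact norm_add_le _ _
        _ = |(Z : ℝ)| * ‖y - ratPt p q‖ * b + k * (b * q' * ‖ratPt p q - ratPt p' q'‖) := by
            rw [norm_smul, norm_smul, Real.norm_eq_abs, Real.norm_eq_abs,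
              abs_of_pos (show (0 : ℝ) < k * q' by positivity)]
            ring
        _ ≤ 1 / N + N * d := by linarith
    have hu : 2 * (1 / N + N * d) < c := by
      calc 2 * (1 / N + N * d) = 2 / N + 2 * N * d := by ring
        _ < c := hNd
    have hu0 : 0 < 1 / N + N * d := by positivity
    by_cases hZ0 : Z = 0
    · have hP0 : ∀ i, P i = 0 := by
        intro i
        have h1 : ‖(fun i => (P i : ℝ))‖ < 1 := by
          have h2 : ‖(Z : ℝ) • y - fun i => (P i : ℝ)‖ = ‖(fun i => (P i : ℝ))‖ := by
            rw [hZ0]; simp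
          rw [h2] at hbound
          nlinarith [norm_nonneg (fun i => (P i : ℝ))]
        have h2 := (norm_le_pi_norm (fun i => (P i : ℝ)) i).trans_lt h1
        rw [Real.norm_eq_abs] at h2
        exact Int.abs_lt_one_iff.1 (by exact_mod_cast h2)
      apply hne
      ext i
      have e1 : (k : ℝ) * p' i = j * p i := by
        have := hP0 i
        simp only [hP, sub_eq_zero] at this
        exact_mod_cast this
      have e2 : (k : ℝ) * q' = j * q := by
        simp only [hZ, sub_eq_zero] at hZ0
        exact_mod_cast hZ0
      simp only [ratPt]
      rw [div_eq_div_iff hq'0.ne' hq0.ne']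
      apply mul_left_cancel₀ hk0'.ne'
      calc (k : ℝ) * (p' i * q) = (k * p' i) * q := by ring
        _ = p i * (j * q) := by rw [e1]; ring
        _ = k * (p i * q') := by rw [← e2]; ring
    · set q'' : ℕ := Z.natAbs with hq''
      have hq1 : 1 ≤ q'' := Int.natAbs_pos.2 hZ0
      have hq2 : (q'' : ℝ) = |(Z : ℝ)| := by rw [hq'', Nat.cast_natAbs]; push_cast; rfl
      have hq3 : q'' ≤ Q := by
        have : (q'' : ℝ) ≤ q := by
          rw [hq2]
          have : (1 : ℝ) ≤ N := by exact_mod_cast hN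
          nlinarith [abs_nonneg (Z : ℝ)]
        exact le_trans (by exact_mod_cast this) hqQ
      set p'' : Fin n → ℤ := fun i => Z.sign * P i with hp''
      have h1 : ‖(q'' : ℝ) • y - fun i => (p'' i : ℝ)‖ = ‖(Z : ℝ) • y - fun i => (P i : ℝ)‖ := by
        have hs : (q'' : ℝ) = Z.sign * Z := by
          have : (q'' : ℤ) = Z.sign * Z := (Int.sign_mul_self_eq_natAbs Z).symm
          exact_mod_cast this
        have : (q'' : ℝ) • y - (fun i => (p'' i : ℝ)) =
            (Z.sign : ℝ) • ((Z : ℝ) • y - fun i => (P i : ℝ)) := by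
          ext i
          simp only [hs, hp'', Pi.sub_apply, Pi.smul_apply, smul_eq_mul]
          push_cast
          ring
        rw [this, norm_smul, Real.norm_eq_abs]
        have : |((Z.sign : ℤ) : ℝ)| = 1 := by
          rcases lt_or_gt_of_ne hZ0 with h | h
          · rw [Int.sign_eq_neg_one_of_neg h]; simp
          · rw [Int.sign_eq_one_of_pos h]; simp
        rw [this, one_mul]
      rw [← h1, norm_smul_sub_intCast y p'' hq1] at hbound
      have h2 := key p'' q'' _ hq1 hq3 (by linarith) hbound
      have hQ0 : (0 : ℝ) < Q := by exact_mod_cast lt_of_lt_of_le hq hqQ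
      have h3 : (2 * (1 / N + N * d)) ^ n * (q'' : ℝ) ≤ (2 * (1 / N + N * d)) ^ n * Q := by
        have : (q'' : ℝ) ≤ Q := by exact_mod_cast hq3
        gcongr
      have h4 : c ≤ (2 * (1 / N + N * d)) ^ n := le_of_mul_le_mul_right (h2.trans h3) hQ0
      have h5 : (2 * (1 / N + N * d)) ^ n ≤ 2 * (1 / N + N * d) :=
        pow_le_of_le_one (by positivity) (by linarith) (by omega)
      linarith

/-! ### Good cubes and the jump to a rational point -/

/-- A cube with centre `x` and radius `ρ` is good when its points are not `c' * ψ`-approximable by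
rational points with small denominators, and moreover badly approximable by those whose denominators
are not too small compared with the scale `r`. -/
def GoodCube {n : ℕ} (ψ : ℕ → ℝ) (c c' θ r : ℝ) (x : Fin n → ℝ) (ρ : ℝ) : Prop :=
  ∀ y, ‖y - x‖ ≤ ρ → ∀ (p : Fin n → ℤ) (q : ℕ), 1 ≤ q → (q : ℝ) ^ (n + 1) * ρ ^ n < θ →
    c' * ψ q ≤ ‖y - ratPt p q‖ ∧
      (θ ≤ (q : ℝ) ^ (n + 1) * r ^ n → c ≤ (q : ℝ) ^ (n + 1) * ‖y - ratPt p q‖ ^ n)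

theorem exists_root_bracket {n Q : ℕ} (hn : 1 ≤ n) (hQ : 1 ≤ Q) :
    ∃ b : ℕ, 1 ≤ b ∧ b ^ n ≤ Q ∧ Q < (b + 1) ^ n := by
  have hex : ∃ b : ℕ, Q < (b + 1) ^ n :=
    ⟨Q, (Nat.lt_succ_self Q).trans_le (Nat.le_self_pow (by omega) _)⟩
  classical
  refine ⟨Nat.find hex, ?_, ?_, Nat.find_spec hex⟩
  · by_contra h
    have h0 : Nat.find hex = 0 := by omega
    have := Nat.find_spec hex
    rw [h0] at this
    simp at this
    omega
  · by_contra h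
    have hb : Nat.find hex ≠ 0 := by
      intro h0
      rw [h0, zero_pow (by omega)] at h
      omega
    have := Nat.find_min hex (m := Nat.find hex - 1) (by omega)
    rw [Nat.sub_add_cancel (by omega)] at this
    omega

set_option maxHeartbeats 1000000 in
/-- A good cube contains a much smaller good cube all of whose points are `ψ`-approximated by a
common rational point with denominator about `Q`. -/
theorem exists_jump {n L N Q : ℕ} (hn : 1 ≤ n) (hL : 1 ≤ L) {ψ : ℕ → ℝ}
    (hpos : ∀ s : ℕ, 1 ≤ s → 0 < ψ s) (hmono : AntitoneOn ψ (Set.Ici 1))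
    {M θ c A c' d e η B K K' r ρ : ℝ} (hM : M = 20 * n * L)
    (hθ : θ = 1 / (M ^ n * (2 ^ n * (n + 1)!))) (hc : c = θ / M ^ n) (hA : A = 2 ^ n / c)
    (hθ1 : θ ≤ 1) (hc1 : c ≤ 1) (hN : 1 ≤ N) (hd : 0 < d) (hNd : 2 / N + 2 * N * d < c)
    (he0 : 0 < e) (he1 : e ≤ 1) (hed : 8 ^ (n + 1) * e ≤ d ^ (n + 1))
    (hB : ∀ q : ℕ, 1 ≤ q → (q : ℝ) ^ (n + 1) * ψ q ^ n ≤ B)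
    (hc'0 : 0 < c') (hc'1 : c' ≤ 1 / 4) (hc'K : c' * K' ≤ 1 / 4) (hKθ : θ ≤ K)
    (hc'B : (2 * c') ^ n * (B * (K / θ)) ≤ d ^ n)
    (hη0 : 0 < η) (hη : ∀ q : ℕ, 1 ≤ q → (q : ℝ) ^ (n + 1) * r ^ n < θ → η ≤ c' * ψ q)
    (hQ : 1 ≤ Q) (hQη : 2 ^ n < Q * η ^ n)
    (hreg : ∀ q : ℕ, 1 ≤ q → q ≤ Q → (Q : ℝ) ≤ A * q → ψ q ≤ K' * ψ Q)
    (he : (Q : ℝ) ^ (n + 1) * ψ Q ^ n ≤ e ^ n) (hρ : 0 < ρ)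
    (hlow : 8 ^ n * A ^ n ≤ (Q : ℝ) ^ (n + 1) * ρ ^ n) (hup : (Q : ℝ) ^ (n + 1) * ρ ^ n ≤ K)
    {x : Fin n → ℝ} (hx : GoodCube ψ c c' θ r x ρ) :
    3 * ψ Q ≤ ρ ∧ ∃ z, ‖z - x‖ + ψ Q / 4 ≤ ρ ∧ GoodCube ψ c c' θ (ψ Q / 4) z (ψ Q / 4) ∧
      ∃ (p : Fin n → ℤ) (q : ℕ), 1 ≤ q ∧ ∀ w, ‖w - z‖ ≤ ψ Q / 4 →
        0 < ‖w - ratPt p q‖ ∧ ‖w - ratPt p q‖ < ψ q ∧ ‖w - ratPt p q‖ ≤ ψ Q := by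
  have : Nonempty (Fin n) := ⟨⟨0, hn⟩⟩
  have hn' : (1 : ℝ) ≤ n := by exact_mod_cast hn
  have hL' : (1 : ℝ) ≤ L := by exact_mod_cast hL
  have hM20 : 20 ≤ M := by rw [hM]; nlinarith
  have hM0 : 0 < M := by linarith
  have hθ0 : 0 < θ := by rw [hθ]; positivity
  have hc0 : 0 < c := by rw [hc]; positivity
  have hA0 : 0 < A := by rw [hA]; positivity
  have hA1 : 1 ≤ A := by
    rw [hA, le_div_iff₀ hc0, one_mul]
    exact hc1.trans (one_le_pow₀ (by norm_num))
  have hQ0 : (0 : ℝ) < Q := by exact_mod_cast hQ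
  obtain ⟨b, hb, hbQ, hQb⟩ := exists_root_bracket hn hQ
  have hb1 : (1 : ℝ) ≤ b := by exact_mod_cast hb
  have hb0 : (0 : ℝ) < b := by linarith
  have hbQ' : (b : ℝ) ^ n ≤ Q := by exact_mod_cast hbQ
  have hQb' : (Q : ℝ) ≤ (2 * b) ^ n := by
    have h1 : (Q : ℝ) < ((b : ℝ) + 1) ^ n := by exact_mod_cast hQb
    exact h1.le.trans (by gcongr; linarith)
  have hbη : 1 < b * η := by
    refine lt_of_pow_lt_pow_left₀ n (by positivity) ?_
    have h1 : (2 : ℝ) ^ n < 2 ^ n * (b * η) ^ n := by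
      calc (2 : ℝ) ^ n < Q * η ^ n := hQη
        _ ≤ (2 * b) ^ n * η ^ n := by gcongr
        _ = 2 ^ n * (b * η) ^ n := by simp only [mul_pow]; ring
    rw [one_pow]
    exact lt_of_mul_lt_mul_left (by rwa [mul_one]) (by positivity : (0 : ℝ) ≤ 2 ^ n)
  obtain ⟨y, hyx, hyb⟩ := exists_bad_point hn hL hM hθ x hρ Q
  rw [← hc] at hyb
  obtain ⟨p, q, hq, hqQ, hyv, hrep, hsep⟩ := exists_isolated_approx hn hc1 hN hd hNd hb hbQ hQb' hbη y
    -- Three ranges of `q`: large ones are handled by the choice of `y`, middle ones by the badness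
    -- clause of the good cube, and small ones lie at distance at least `η`.
    (by
      intro p q hq hqQ
      by_cases h1 : θ ≤ (q : ℝ) ^ (n + 1) * ρ ^ n
      · exact Or.inl (hyb p q hq hqQ h1)
      · obtain ⟨h2, h3⟩ := hx y (by linarith) p q hq (not_le.1 h1)
        by_cases h4 : θ ≤ (q : ℝ) ^ (n + 1) * r ^ n
        · exact Or.inl (h3 h4)
        · exact Or.inr ((hη q hq (not_le.1 h4)).trans h2))
  set v := ratPt p q with hv
  set s := ψ Q with hs
  have hs0 : 0 < s := hpos Q hQ
  have hq0 : (0 : ℝ) < q := by exact_mod_cast hq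
  have hrep' : ∀ (p' : Fin n → ℤ) (q' : ℕ), 1 ≤ q' → q' ≤ Q → ratPt p' q' = v →
      (Q : ℝ) ≤ A * q' := by
    intro p' q' h1 h2 h3
    rw [hA, div_mul_eq_mul_div, le_div_iff₀ hc0, mul_comm]
    exact hrep p' q' h1 h2 h3
  have hQn : (0 : ℝ) < (Q : ℝ) ^ (n + 1) := by positivity
  have hyv4 : 4 * ‖y - v‖ ≤ ρ := by
    refine le_of_pow_le_pow_left₀ (by omega : n ≠ 0) hρ.le ?_
    refine le_of_mul_le_mul_left (le_trans ?_ hlow) hQn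
    have h1 := hrep' p q hq hqQ rfl
    calc (Q : ℝ) ^ (n + 1) * (4 * ‖y - v‖) ^ n = Q ^ n * Q * (4 * ‖y - v‖) ^ n := by ring
      _ ≤ (A * q) ^ n * (2 * b) ^ n * (4 * ‖y - v‖) ^ n := by gcongr
      _ = (2 * 4) ^ n * A ^ n * (‖y - v‖ * (b * q)) ^ n := by simp only [mul_pow]; ring
      _ ≤ (2 * 4) ^ n * A ^ n * 1 ^ n := by gcongr
      _ = 8 ^ n * A ^ n := by norm_num
  have h3s : 3 * s ≤ ρ := by
    refine le_of_pow_le_pow_left₀ (by omega : n ≠ 0) hρ.le ?_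
    refine le_of_mul_le_mul_left (le_trans ?_ hlow) hQn
    calc (Q : ℝ) ^ (n + 1) * (3 * s) ^ n = 3 ^ n * (Q ^ (n + 1) * s ^ n) := by
          simp only [mul_pow]; ring
      _ ≤ 8 ^ n * A ^ n := by
          have h1 : (Q : ℝ) ^ (n + 1) * s ^ n ≤ A ^ n :=
            he.trans ((pow_le_one₀ he0.le he1).trans (one_le_pow₀ hA1))
          gcongr
          norm_num
  -- The cube of radius `s / 4` about `z` stays at distances between `s / 4` and `3 * s / 4` from
  -- `v`.
  set z : Fin n → ℝ := v + fun _ => s / 2 with hz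
  have hzv : ‖z - v‖ = s / 2 := by
    rw [hz, add_sub_cancel_left, pi_norm_const, Real.norm_eq_abs, abs_of_pos (by positivity)]
  have hzx : ‖z - x‖ + s / 4 ≤ ρ := by
    have : ‖z - x‖ ≤ ‖z - v‖ + ‖y - v‖ + ‖y - x‖ := by
      calc ‖z - x‖ = ‖(z - v) - (y - v) + (y - x)‖ := by congr 1; abel
        _ ≤ ‖(z - v) - (y - v)‖ + ‖y - x‖ := norm_add_le _ _
        _ ≤ _ := by gcongr; exact norm_sub_le _ _
    linarith
  have hwv : ∀ w, ‖w - z‖ ≤ s / 4 → s / 4 ≤ ‖w - v‖ ∧ ‖w - v‖ ≤ 3 / 4 * s := by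
    intro w hw
    constructor
    · have : ‖z - v‖ ≤ ‖w - v‖ + ‖w - z‖ := by
        calc ‖z - v‖ = ‖(w - v) - (w - z)‖ := by congr 1; abel
          _ ≤ _ := norm_sub_le _ _
      linarith
    · have : ‖w - v‖ ≤ ‖w - z‖ + ‖z - v‖ := by
        calc ‖w - v‖ = ‖(w - z) + (z - v)‖ := by congr 1; abel
          _ ≤ _ := norm_add_le _ _
      linarith
  refine ⟨h3s, z, hzx, ?_, p, q, hq, ?_⟩
  · intro w hw p' q' hq' hqs
    -- The badness clause is vacuous because the reference scale is restarted at the new radius.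
    refine ⟨?_, fun h => absurd h (not_le.2 hqs)⟩
    obtain ⟨hw1, hw2⟩ := hwv w hw
    have hq'0 : (0 : ℝ) < q' := by exact_mod_cast hq'
    -- The point `v` itself may have several denominators: those up to `Q` are comparable with `Q`,
    -- where decay of `ψ` is controlled, and beyond `Q` monotonicity suffices.
    by_cases hvv : ratPt p' q' = v
    · rw [hvv]
      refine le_trans ?_ hw1
      by_cases hle : q' ≤ Q
      · calc c' * ψ q' ≤ c' * (K' * s) := by
              gcongr; exact hreg q' hq' hle (hrep' p' q' hq' hle hvv)
          _ = (c' * K') * s := by ring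
          _ ≤ 1 / 4 * s := by gcongr
          _ = s / 4 := by ring
      · have h1 : ψ q' ≤ s := hmono (by exact hQ) (by exact hq') (not_le.1 hle).le
        calc c' * ψ q' ≤ 1 / 4 * s := mul_le_mul hc'1 h1 (hpos q' hq').le (by norm_num)
          _ = s / 4 := by ring
    · have hδ := hsep p' q' hq' hvv
      set δ := ‖v - ratPt p' q'‖ with hδdef
      have hbq : (0 : ℝ) < b * q' := by positivity
      -- With `q' ^ (n + 1) * s ^ n` bounded and `b ^ (n + 1) * s ≤ e`, the number `b * q' * (2 *
      -- s)` is at most `d`, so isolation puts `ratPt p' q'` well outside the new cube.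
      have hδs : 2 * s ≤ δ := by
        refine le_of_mul_le_mul_left (le_trans ?_ hδ) hbq
        refine le_of_pow_le_pow_left₀ (by omega : n + 1 ≠ 0) hd.le (le_trans ?_ hed)
        have h1 : s * b ^ (n + 1) ≤ e := by
          refine le_of_pow_le_pow_left₀ (by omega : n ≠ 0) he0.le (le_trans ?_ he)
          calc (s * (b : ℝ) ^ (n + 1)) ^ n = ((b : ℝ) ^ n) ^ (n + 1) * s ^ n := by ring
            _ ≤ _ := by gcongr
        have h2 : (q' : ℝ) ^ (n + 1) * s ^ n ≤ 4 ^ n := by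
          have h3 : (q' : ℝ) ^ (n + 1) * s ^ n = 4 ^ n * ((q' : ℝ) ^ (n + 1) * (s / 4) ^ n) := by
            rw [div_pow]; field_simp
          rw [h3]
          exact mul_le_of_le_one_right (by positivity) (hqs.le.trans hθ1)
        calc (b * q' * (2 * s)) ^ (n + 1)
            = 2 ^ (n + 1) * ((q' : ℝ) ^ (n + 1) * s ^ n) * (s * b ^ (n + 1)) := by ring
          _ ≤ 2 ^ (n + 1) * 4 ^ n * e := by gcongr
          _ ≤ 2 ^ (n + 1) * 4 ^ (n + 1) * e := by
            gcongr
            · norm_num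
            · omega
          _ = 8 ^ (n + 1) * e := by rw [← mul_pow]; norm_num
      have hwδ : δ / 2 ≤ ‖w - ratPt p' q'‖ := by
        have : δ ≤ ‖w - ratPt p' q'‖ + ‖w - v‖ := by
          calc δ = ‖(w - ratPt p' q') - (w - v)‖ := by rw [hδdef]; congr 1; abel
            _ ≤ _ := norm_sub_le _ _
        linarith
      by_cases hqρ : (q' : ℝ) ^ (n + 1) * ρ ^ n < θ
      · refine (hx w ?_ p' q' hq' hqρ).1
        calc ‖w - x‖ = ‖(w - z) + (z - x)‖ := by congr 1; abel
          _ ≤ ‖w - z‖ + ‖z - x‖ := norm_add_le _ _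
          _ ≤ ρ := by linarith
      · push Not at hqρ
        refine le_trans ?_ hwδ
        have hψq := hpos q' hq'
        have hKθ1 : 1 ≤ K / θ := by rwa [le_div_iff₀ hθ0, one_mul]
        -- The old cube says nothing about this `q'`, but `q'` is at least a constant times `Q`, so
        -- the isolation distance `d / (b * q')` dominates `2 * c' * ψ q'`.
        have hQq : (Q : ℝ) ≤ K / θ * q' := by
          refine le_of_pow_le_pow_left₀ (by omega : n + 1 ≠ 0) (by positivity) ?_
          refine le_of_mul_le_mul_right ?_ (pow_pos hρ n)
          calc (Q : ℝ) ^ (n + 1) * ρ ^ n ≤ K := hup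
            _ = K / θ * θ := by field_simp
            _ ≤ (K / θ) * ((q' : ℝ) ^ (n + 1) * ρ ^ n) := by gcongr
            _ ≤ (K / θ) ^ (n + 1) * ((q' : ℝ) ^ (n + 1) * ρ ^ n) := by
              gcongr
              exact le_self_pow₀ hKθ1 (by omega)
            _ = _ := by ring
        have h1 : 2 * c' * ψ q' * (b * q') ≤ d := by
          refine le_of_pow_le_pow_left₀ (by omega : n ≠ 0) hd.le (le_trans ?_ hc'B)
          refine le_of_mul_le_mul_right ?_ hq'0
          calc (2 * c' * ψ q' * (b * q')) ^ n * q'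
              = (2 * c') ^ n * (((q' : ℝ) ^ (n + 1) * ψ q' ^ n) * b ^ n) := by
                simp only [mul_pow]; ring
            _ ≤ (2 * c') ^ n * (B * (K / θ * q')) := by
              have hB0 : 0 ≤ B := le_trans (by positivity) (hB q' hq')
              gcongr
              · exact hB q' hq'
              · exact hbQ'.trans hQq
            _ = _ := by ring
        have h2 : 2 * c' * ψ q' ≤ δ := by
          refine le_of_mul_le_mul_left (le_trans ?_ hδ) hbq
          rwa [mul_comm]
        linarith
  · intro w hw
    obtain ⟨hw1, hw2⟩ := hwv w hw
    have h1 : s ≤ ψ q := hmono (by exact hq) (by exact hQ) hqQ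
    refine ⟨by linarith, by linarith, by linarith⟩

/-! ### The mass distribution principle -/

/-- **Mass distribution principle** for a Cantor set constructed from a regular tree of balls. -/
theorem le_dimH_of_tree {D E : Type*} [Fintype D] [Nonempty D] [NormedAddCommGroup E]
    [CompleteSpace E] (hcard : 2 ≤ Fintype.card D) {ρ : ℕ → ℝ} {s : ℝ≥0} (hs : 0 < s)
    (hρ0 : ρ 0 = 1) (hρpos : ∀ m, 0 < ρ m) (hρanti : Antitone ρ) (hρlim : Tendsto ρ atTop (𝓝 0))
    (hmass : ∀ m, ((Fintype.card D : ℝ) ^ m)⁻¹ ≤ ρ m ^ (s : ℝ)) {Node : ℕ → E → Prop} {x₀ : E}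
    (h₀ : Node 0 x₀)
    (hstep : ∀ m x, Node m x → ∃ F : D → E,
      (∀ i, Node (m + 1) (F i) ∧ ‖F i - x‖ + ρ (m + 1) ≤ ρ m) ∧
      ∀ i j, i ≠ j → ∀ w w', ‖w - F i‖ ≤ ρ (m + 1) → ‖w' - F j‖ ≤ ρ (m + 1) →
        2 * ρ (m + 1) ≤ ‖w - w'‖)
    {A : Set E} (hA : ∀ w, (∀ m, ∃ x, Node m x ∧ ‖w - x‖ ≤ ρ m) → w ∈ A) :
    (s : ℝ≥0∞) ≤ dimH A := by
  classical
  borelize E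
  let _ : MeasurableSpace D := ⊤
  -- Children are made total, with a dummy constant map off the nodes, to allow recursion along
  -- branches.
  have hstep' : ∀ m x, ∃ F : D → E, Node m x →
      (∀ i, Node (m + 1) (F i) ∧ ‖F i - x‖ + ρ (m + 1) ≤ ρ m) ∧
      ∀ i j, i ≠ j → ∀ w w', ‖w - F i‖ ≤ ρ (m + 1) → ‖w' - F j‖ ≤ ρ (m + 1) →
        2 * ρ (m + 1) ≤ ‖w - w'‖ := by
    intro m x
    by_cases h : Node m x
    · obtain ⟨F, hF⟩ := hstep m x h
      exact ⟨F, fun _ => hF⟩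
    · exact ⟨fun _ => x, fun h' => absurd h' h⟩
  choose F hF using hstep'
  let X : ℕ → (ℕ → D) → E := fun m ω => Nat.rec x₀ (fun k x => F k x (ω k)) m
  have hX1 : ∀ m ω, X (m + 1) ω = F m (X m ω) (ω m) := fun _ _ => rfl
  have hnode : ∀ m ω, Node m (X m ω) := by
    intro m ω
    induction m with
    | zero => exact h₀
    | succ m ih => rw [hX1]; exact ((hF m _ ih).1 _).1
  have hnest : ∀ ω m k, ‖X (m + k) ω - X m ω‖ + ρ (m + k) ≤ ρ m := by
    intro ω m k
    induction k with
    | zero => simp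
    | succ k ih =>
      have h1 := ((hF (m + k) _ (hnode (m + k) ω)).1 (ω (m + k))).2
      rw [← hX1] at h1
      have h2 := norm_add_le (X (m + k + 1) ω - X (m + k) ω) (X (m + k) ω - X m ω)
      rw [sub_add_sub_cancel] at h2
      rw [← add_assoc]
      linarith
  have hcau : ∀ ω, CauchySeq fun m => X m ω := by
    intro ω
    refine cauchySeq_of_le_tendsto_0 (fun m => 2 * ρ m) ?_ (by simpa using hρlim.const_mul 2)
    intro a b N ha hb
    obtain ⟨k, rfl⟩ := Nat.exists_eq_add_of_le ha
    obtain ⟨l, rfl⟩ := Nat.exists_eq_add_of_le hb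
    have h1 := hnest ω N k
    have h2 := hnest ω N l
    have h3 := hρpos (N + k)
    have h4 := hρpos (N + l)
    have h5 := norm_sub_le (X (N + k) ω - X N ω) (X (N + l) ω - X N ω)
    rw [sub_sub_sub_cancel_right] at h5
    rw [dist_eq_norm]
    linarith
  choose π hπ using fun ω => cauchySeq_tendsto_of_complete (hcau ω)
  have hπX : ∀ ω m, ‖π ω - X m ω‖ ≤ ρ m := by
    intro ω m
    refine le_of_tendsto ((hπ ω).sub_const (X m ω)).norm ?_
    filter_upwards [eventually_ge_atTop m] with a ha
    obtain ⟨k, rfl⟩ := Nat.exists_eq_add_of_le ha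
    have := hnest ω m k
    have := hρpos (m + k)
    linarith
  have hprefix : ∀ m ω ω', (∀ i < m, ω i = ω' i) → X m ω = X m ω' := by
    intro m ω ω'
    induction m with
    | zero => intro _; rfl
    | succ m ih =>
      intro h
      rw [hX1, hX1, ih fun i hi => h i (by omega), h m (by omega)]
  -- Branches first differing at `k < m` are at least `2 * ρ (k + 1) ≥ 2 * ρ m` apart.
  have hsep : ∀ m ω ω', ‖π ω - π ω'‖ < 2 * ρ m → ∀ i < m, ω i = ω' i := by
    intro m ω ω' hlt
    by_contra hne
    push Not at hne
    have hspec := Nat.find_spec hne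
    set k := Nat.find hne with hk
    obtain ⟨hkm, hkne⟩ := hspec
    have hpre : X k ω = X k ω' := hprefix k ω ω' fun i hi => by
      have := Nat.find_min hne hi
      push Not at this
      exact this (hi.trans hkm)
    have h1 := hπX ω (k + 1)
    have h2 := hπX ω' (k + 1)
    rw [hX1] at h1 h2
    rw [← hpre] at h2
    have h3 := (hF k _ (hnode k ω)).2 _ _ hkne _ _ h1 h2
    have h4 := hρanti (show k + 1 ≤ m by omega)
    linarith
  have hXmeas : ∀ m (S : Set E), MeasurableSet (X m ⁻¹' S) := by
    intro m
    induction m with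
    | zero => intro S; exact MeasurableSet.const (x₀ ∈ S)
    | succ m ih =>
      intro S
      have : X (m + 1) ⁻¹' S =
          ⋃ d : D, (fun ω : ℕ → D => ω m) ⁻¹' {d} ∩ X m ⁻¹' {x | F m x d ∈ S} := by
        ext ω
        simp [hX1]
      rw [this]
      exact MeasurableSet.iUnion fun d =>
        ((measurable_pi_apply m) (MeasurableSpace.measurableSet_top)).inter (ih _)
  have hπmeas : Measurable π :=
    measurable_of_tendsto_metrizable (f := X) (fun m S _ => hXmeas m S) (tendsto_pi_nhds.2 hπ)
  let ν : Measure D := (PMF.uniformOfFintype D).toMeasure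
  let P : Measure (ℕ → D) := Measure.infinitePi fun _ => ν
  set N := Fintype.card D with hN
  have hN0 : (0 : ℝ) < N := by exact_mod_cast (by omega : 0 < N)
  have hcyl : ∀ m (ω₀ : ℕ → D), P {ω | ∀ i < m, ω i = ω₀ i} = ENNReal.ofReal (((N : ℝ) ^ m)⁻¹) := by
    intro m ω₀
    have h1 : {ω : ℕ → D | ∀ i < m, ω i = ω₀ i} =
        Set.pi (Finset.range m : Set ℕ) (fun i => {ω₀ i}) := by
      ext ω; simp [Set.mem_pi]
    rw [h1, Measure.infinitePi_pi _ (fun i _ => MeasurableSpace.measurableSet_top)]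
    have h2 : ∀ i, ν {ω₀ i} = ENNReal.ofReal ((N : ℝ)⁻¹) := by
      intro i
      rw [PMF.toMeasure_apply_singleton _ _ MeasurableSpace.measurableSet_top,
        PMF.uniformOfFintype_apply, ENNReal.ofReal_inv_of_pos hN0, ENNReal.ofReal_natCast]
    simp only [h2, Finset.prod_const, Finset.card_range]
    rw [← ENNReal.ofReal_pow (by positivity), inv_pow]
  have hpre : ∀ (U : Set E) m, Metric.ediam U < ENNReal.ofReal (2 * ρ m) →
      P (π ⁻¹' U) ≤ ENNReal.ofReal (((N : ℝ) ^ m)⁻¹) := by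
    intro U m hU
    rcases (π ⁻¹' U).eq_empty_or_nonempty with h | ⟨ω₀, hω₀⟩
    · rw [h]; simp
    · rw [← hcyl m ω₀]
      refine measure_mono fun ω hω => hsep m ω ω₀ ?_
      have h1 : edist (π ω) (π ω₀) < ENNReal.ofReal (2 * ρ m) :=
        (Metric.edist_le_ediam_of_mem (s := U) hω hω₀).trans_lt hU
      rw [edist_dist, dist_eq_norm] at h1
      exact (ENNReal.ofReal_lt_ofReal_iff (by have := hρpos m; positivity)).1 h1
  have hbound : ∀ U : Set E, Metric.ediam U ≤ 1 →
      (Measure.map π P) U ≤ (N : ℝ≥0∞) * Metric.ediam U ^ (s : ℝ) := by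
    intro U hU
    rw [← Metric.ediam_closure] at hU ⊢
    refine (measure_mono subset_closure).trans ?_
    rw [Measure.map_apply hπmeas isClosed_closure.measurableSet]
    set V := closure U
    rcases eq_or_ne (Metric.ediam V) 0 with h0 | h0
    · rw [h0, ENNReal.zero_rpow_of_pos (by exact_mod_cast hs), mul_zero]
      have hlim : Tendsto (fun m : ℕ => ENNReal.ofReal (((N : ℝ) ^ m)⁻¹)) atTop (𝓝 0) := by
        rw [← ENNReal.ofReal_zero]
        refine ENNReal.tendsto_ofReal ?_
        refine (tendsto_pow_atTop_atTop_of_one_lt ?_).inv_tendsto_atTop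
        exact_mod_cast (by omega : 1 < N)
      refine ge_of_tendsto' hlim fun m => hpre V m ?_
      rw [h0]
      have := hρpos m
      exact ENNReal.ofReal_pos.2 (by positivity)
    · set δ := (Metric.ediam V).toReal with hδ
      have hVtop : Metric.ediam V ≠ ∞ := ne_top_of_le_ne_top ENNReal.one_ne_top hU
      have hδ0 : 0 < δ := ENNReal.toReal_pos h0 hVtop
      have hVδ : Metric.ediam V = ENNReal.ofReal δ := (ENNReal.ofReal_toReal hVtop).symm
      have hδ1 : δ ≤ 1 := ENNReal.toReal_le_of_le_ofReal zero_le_one (by simpa using hU)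
      -- The level `m` satisfies `2 * ρ (m + 1) ≤ δ < 2 * ρ m`. Since radii may drop arbitrarily in
      -- one step, the mass bound is used at `m + 1`, at the price of a factor `N`. Level 0 is
      -- excluded because `2 * ρ 0 = 2 > δ`.
      have hex : ∃ k, 2 * ρ k ≤ δ := by
        have h2 : Tendsto (fun k => 2 * ρ k) atTop (𝓝 0) := by simpa using hρlim.const_mul 2
        obtain ⟨k, hk⟩ := (h2.eventually (gt_mem_nhds hδ0)).exists
        exact ⟨k, hk.le⟩
      obtain ⟨m, hm⟩ : ∃ m, Nat.find hex = m + 1 := by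
        refine Nat.exists_eq_succ_of_ne_zero fun h => ?_
        have := Nat.find_spec hex
        rw [h, hρ0] at this
        linarith
      have h1 : 2 * ρ (m + 1) ≤ δ := by have := Nat.find_spec hex; rwa [hm] at this
      have h2 : δ < 2 * ρ m := not_le.1 (Nat.find_min hex (by omega))
      have hρm := hρpos (m + 1)
      calc P (π ⁻¹' V) ≤ ENNReal.ofReal (((N : ℝ) ^ m)⁻¹) :=
            hpre V m (by rw [hVδ]; exact (ENNReal.ofReal_lt_ofReal_iff (by linarith)).2 h2)
        _ ≤ ENNReal.ofReal (N * δ ^ (s : ℝ)) := by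
            refine ENNReal.ofReal_le_ofReal ?_
            calc ((N : ℝ) ^ m)⁻¹ = N * ((N : ℝ) ^ (m + 1))⁻¹ := by rw [pow_succ]; field_simp
              _ ≤ N * ρ (m + 1) ^ (s : ℝ) := by gcongr; exact hmass _
              _ ≤ N * δ ^ (s : ℝ) := by gcongr; linarith
        _ = N * Metric.ediam V ^ (s : ℝ) := by
            rw [ENNReal.ofReal_mul hN0.le, ENNReal.ofReal_natCast, hVδ,
              ENNReal.ofReal_rpow_of_pos hδ0]
  have hN0' : (N : ℝ≥0∞) ≠ 0 := by exact_mod_cast (by omega : N ≠ 0)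
  have hle : (N : ℝ≥0∞)⁻¹ • Measure.map π P ≤ Measure.hausdorffMeasure (s : ℝ) := by
    refine Measure.le_hausdorffMeasure _ _ 1 one_pos fun U hU => ?_
    rw [Measure.smul_apply, smul_eq_mul]
    calc (N : ℝ≥0∞)⁻¹ * (Measure.map π P) U
        ≤ (N : ℝ≥0∞)⁻¹ * ((N : ℝ≥0∞) * Metric.ediam U ^ (s : ℝ)) := by gcongr; exact hbound U hU
      _ = Metric.ediam U ^ (s : ℝ) := by
        rw [← mul_assoc, ENNReal.inv_mul_cancel hN0' (ENNReal.natCast_ne_top N), one_mul]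
  refine le_dimH_of_hausdorffMeasure_ne_zero ?_
  have huniv : π ⁻¹' A = univ :=
    eq_univ_of_forall fun ω => hA _ fun m => ⟨X m ω, hnode m ω, hπX ω m⟩
  have h1 : (1 : ℝ≥0∞) ≤ (Measure.map π P) A := by
    calc (1 : ℝ≥0∞) = P (π ⁻¹' A) := by rw [huniv]; exact measure_univ.symm
      _ ≤ _ := Measure.le_map_apply hπmeas.aemeasurable A
  have h2 : (N : ℝ≥0∞)⁻¹ * 1 ≤ Measure.hausdorffMeasure (s : ℝ) A := by
    refine le_trans ?_ (hle A)
    rw [Measure.smul_apply, smul_eq_mul]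
    gcongr
  rw [mul_one] at h2
  exact (lt_of_lt_of_le (ENNReal.inv_pos.2 (ENNReal.natCast_ne_top N)) h2).ne'

/-! ### The covering bound -/

theorem finite_setOf_ratPt_near {n : ℕ} (x : Fin n → ℝ) {q : ℕ} (hq : 1 ≤ q) (r : ℝ) :
    {p : Fin n → ℤ | ‖x - ratPt p q‖ < r}.Finite := by
  have hq0 : (0 : ℝ) < q := by exact_mod_cast hq
  refine (Set.finite_Icc (fun i => ⌊q * (x i - r)⌋) (fun i => ⌈q * (x i + r)⌉)).subset ?_
  intro p hp
  have h : ∀ i, (x i - r) * q ≤ p i ∧ (p i : ℝ) ≤ (x i + r) * q := by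
    intro i
    have h1 := (norm_le_pi_norm (x - ratPt p q) i).trans hp.le
    rw [Pi.sub_apply, Real.norm_eq_abs, abs_le] at h1
    simp only [ratPt] at h1
    rw [← le_div_iff₀ hq0, ← div_le_iff₀ hq0]
    constructor <;> linarith
  refine ⟨fun i => ?_, fun i => ?_⟩
  · have : (⌊q * (x i - r)⌋ : ℝ) ≤ p i := (Int.floor_le _).trans (by linarith [(h i).1])
    exact_mod_cast this
  · have : (p i : ℝ) ≤ ⌈q * (x i + r)⌉ := le_trans (by linarith [(h i).2]) (Int.le_ceil _)
    exact_mod_cast this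

/-- Each denominator contributes only finitely many points, so infinitely many points need unbounded
denominators. -/
theorem exists_ratPt_of_mem_approximableSet {n : ℕ} {ψ : ℕ → ℝ} {x : Fin n → ℝ}
    (hx : x ∈ approximableSet n ψ) (Q : ℕ) :
    ∃ (p : Fin n → ℤ) (q : ℕ), 1 ≤ q ∧ Q ≤ q ∧ ‖x - ratPt p q‖ < ψ q := by
  by_contra hcon
  push Not at hcon
  refine hx ?_
  have hfin : (⋃ q ∈ Finset.Ico 1 Q, (fun (p : Fin n → ℤ) (i : Fin n) => (p i : ℚ) / (q : ℚ)) ''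
      {p : Fin n → ℤ | ‖x - ratPt p q‖ < ψ q}).Finite := by
    refine Set.Finite.biUnion (Finset.finite_toSet _) fun q hq => ?_
    exact (finite_setOf_ratPt_near x (Finset.mem_Ico.1 hq).1 _).image _
  refine hfin.subset ?_
  rintro v ⟨q, p, hq, hv, hlt⟩
  have hqQ : q < Q := by
    by_contra h
    exact absurd (hcon p q hq (not_lt.1 h)) (not_le.2 hlt)
  simp only [mem_iUnion]
  exact ⟨q, Finset.mem_Ico.2 ⟨hq, hqQ⟩, p, hlt, (funext hv).symm⟩

/-- The covering bound for the Hausdorff dimension of the `ψ`-approximable points. -/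
theorem dimH_approximableSet_le {n : ℕ} {ψ : ℕ → ℝ} {s₁ : ℝ} {s : ℝ≥0} (hs₁ : 0 < s₁)
    (hs : s₁ < s) (hψ : ∀ᶠ q : ℕ in atTop, ψ q ≤ (q : ℝ) ^ (-(((n : ℝ) + 1) / s₁))) :
    dimH (approximableSet n ψ) ≤ s := by
  have hs0 : (0 : ℝ) < s := hs₁.trans hs
  set τ : ℝ := ((n : ℝ) + 1) / s₁ with hτ
  have hτ0 : 0 < τ := by positivity
  have hcover : approximableSet n ψ ⊆ ⋃ R : ℕ, approximableSet n ψ ∩ {x | ‖x‖ ≤ R} := by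
    intro x hx
    obtain ⟨R, hR⟩ := exists_nat_ge ‖x‖
    exact mem_iUnion.2 ⟨R, hx, hR⟩
  refine (dimH_mono hcover).trans ?_
  rw [dimH_iUnion]
  refine iSup_le fun R => dimH_le_of_hausdorffMeasure_ne_top ?_
  set f : ℕ → ℝ≥0∞ := fun q =>
    (((2 * ((R + 1) * q) + 1) ^ n : ℕ) : ℝ≥0∞) * ENNReal.ofReal (2 * (q : ℝ) ^ (-τ)) ^ (s : ℝ) with hf
  set I : ℕ → Finset (Fin n → ℤ) := fun q =>
    Finset.Icc (fun _ => -(((R + 1) * q : ℕ) : ℤ)) (fun _ => (((R + 1) * q : ℕ) : ℤ)) with hI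
  have hIcard : ∀ q, (I q).card = (2 * ((R + 1) * q) + 1) ^ n := by
    intro q
    simp only [hI, Pi.card_Icc, Int.card_Icc, Finset.prod_const, Finset.card_univ, Fintype.card_fin]
    congr 1
    omega
  classical
  -- The index `(k, p)` stands for denominator `k + Q`; numerators out of range get the empty set,
  -- which adds nothing to the sum.
  set U : ℕ → ℕ × (Fin n → ℤ) → Set (Fin n → ℝ) := fun Q kp =>
    if kp.2 ∈ I (kp.1 + Q) then
      Metric.closedBall (ratPt kp.2 (kp.1 + Q)) (((kp.1 + Q : ℕ) : ℝ) ^ (-τ)) else ∅ with hU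
  have hdiam : ∀ (x : Fin n → ℝ) (r : ℝ), Metric.ediam (Metric.closedBall x r) ≤ ENNReal.ofReal (2 * r) := by
    intro x r
    refine Metric.ediam_le fun y hy z hz => ?_
    rw [edist_dist]
    refine ENNReal.ofReal_le_ofReal ?_
    have := dist_triangle_right y z x
    rw [Metric.mem_closedBall] at hy hz
    linarith
  have hUdiam : ∀ Q kp, Metric.ediam (U Q kp) ≤ ENNReal.ofReal (2 * ((kp.1 + Q : ℕ) : ℝ) ^ (-τ)) := by
    intro Q kp
    by_cases h : kp.2 ∈ I (kp.1 + Q)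
    · simp only [hU, h, if_true]; exact hdiam _ _
    · simp [hU, h]
  have hsumU : ∀ Q, ∑' kp, Metric.ediam (U Q kp) ^ (s : ℝ) ≤ ∑' k, f (k + Q) := by
    intro Q
    rw [ENNReal.tsum_prod']
    refine ENNReal.tsum_le_tsum fun k => ?_
    rw [tsum_eq_sum (s := I (k + Q)) (fun p hp => by simp [hU, hp, ENNReal.zero_rpow_of_pos hs0])]
    refine (Finset.sum_le_card_nsmul _ _ (ENNReal.ofReal (2 * ((k + Q : ℕ) : ℝ) ^ (-τ)) ^ (s : ℝ))
      fun p _ => ?_).trans ?_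
    · have := hUdiam Q (k, p)
      gcongr
    · rw [hIcard, nsmul_eq_mul]
  have hfsum : ∑' q, f q ≠ ∞ := by
    set C : ℝ := (3 * ((R : ℝ) + 1)) ^ n * 2 ^ (s : ℝ) with hC
    have hle : ∀ q, f (q + 1) ≤ ENNReal.ofReal (C * ((q + 1 : ℕ) : ℝ) ^ (n - τ * s)) := by
      intro q
      set a : ℝ := ((q + 1 : ℕ) : ℝ) with ha
      have ha1 : (1 : ℝ) ≤ a := by rw [ha]; push_cast; linarith [(Nat.cast_nonneg q : (0 : ℝ) ≤ q)]
      have ha0 : 0 < a := by linarith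
      have e1 : f (q + 1) = ENNReal.ofReal ((2 * ((R + 1) * a) + 1) ^ n * (2 * a ^ (-τ)) ^ (s : ℝ)) := by
        rw [ENNReal.ofReal_mul (by positivity), ← ENNReal.ofReal_rpow_of_pos (by positivity)]
        simp only [hf]
        congr 1
        rw [← ENNReal.ofReal_natCast]
        congr 1
        push_cast [ha]
        ring
      rw [e1]
      refine ENNReal.ofReal_le_ofReal ?_
      have e2 : (2 * a ^ (-τ)) ^ (s : ℝ) = 2 ^ (s : ℝ) * a ^ (-(τ * s)) := by
        rw [Real.mul_rpow (by norm_num) (by positivity), ← Real.rpow_mul ha0.le]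
        congr 2; ring
      have e3 : a ^ ((n : ℝ) - τ * s) = a ^ n * a ^ (-(τ * s)) := by
        rw [sub_eq_add_neg, Real.rpow_add ha0, Real.rpow_natCast]
      rw [e2, e3, hC]
      have e4 : (2 * (((R : ℝ) + 1) * a) + 1) ^ n ≤ (3 * ((R : ℝ) + 1)) ^ n * a ^ n := by
        rw [← mul_pow]
        gcongr
        have : (0 : ℝ) ≤ R * a := by positivity
        nlinarith
      calc (2 * (((R : ℝ) + 1) * a) + 1) ^ n * (2 ^ (s : ℝ) * a ^ (-(τ * s)))
          ≤ (3 * ((R : ℝ) + 1)) ^ n * a ^ n * (2 ^ (s : ℝ) * a ^ (-(τ * s))) := by gcongr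
        _ = _ := by ring
    have hsum : Summable fun q : ℕ => C * ((q + 1 : ℕ) : ℝ) ^ (n - τ * s) := by
      refine Summable.mul_left _ ?_
      refine (summable_nat_add_iff (f := fun q : ℕ => (q : ℝ) ^ (n - τ * s)) 1).2 ?_
      rw [Real.summable_nat_rpow]
      -- About `q ^ n` balls of radius `q ^ (-τ)`: the series converges exactly when `τ * s > n +
      -- 1`.
      have : ((n : ℝ) + 1) < τ * s := by
        rw [hτ, div_mul_eq_mul_div, lt_div_iff₀ hs₁]
        have : (0 : ℝ) < n + 1 := by positivity
        nlinarith
      linarith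
    rw [tsum_eq_zero_add' ENNReal.summable]
    refine ENNReal.add_ne_top.2 ⟨?_, ?_⟩
    · exact ENNReal.mul_ne_top (ENNReal.natCast_ne_top _)
        (ENNReal.rpow_ne_top_of_nonneg hs0.le ENNReal.ofReal_ne_top)
    · exact ne_top_of_le_ne_top hsum.tsum_ofReal_ne_top (ENNReal.tsum_le_tsum hle)
  have hlim : Tendsto (fun Q => ∑' kp, Metric.ediam (U Q kp) ^ (s : ℝ)) atTop (𝓝 0) :=
    tendsto_of_tendsto_of_tendsto_of_le_of_le tendsto_const_nhds
      (ENNReal.tendsto_sum_nat_add f hfsum) (fun _ => zero_le) hsumU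
  have hzero : Measure.hausdorffMeasure (s : ℝ) (approximableSet n ψ ∩ {x | ‖x‖ ≤ R}) ≤ 0 := by
    rw [← hlim.liminf_eq]
    refine Measure.hausdorffMeasure_le_liminf_tsum _ _
      (fun Q : ℕ => ENNReal.ofReal (2 * (Q : ℝ) ^ (-τ))) ?_ U ?_ ?_
    · rw [← ENNReal.ofReal_zero]
      refine ENNReal.tendsto_ofReal ?_
      have := (tendsto_rpow_neg_atTop hτ0).comp tendsto_natCast_atTop_atTop
      simpa using this.const_mul 2
    · filter_upwards [eventually_ge_atTop 1] with Q hQ kp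
      refine (hUdiam Q kp).trans (ENNReal.ofReal_le_ofReal ?_)
      have hQ0 : (0 : ℝ) < Q := by exact_mod_cast hQ
      have : (Q : ℝ) ≤ ((kp.1 + Q : ℕ) : ℝ) := by exact_mod_cast Nat.le_add_left _ _
      have := Real.rpow_le_rpow_of_nonpos hQ0 this (neg_nonpos.2 hτ0.le)
      linarith
    · obtain ⟨Q₀, hQ₀⟩ := eventually_atTop.1 hψ
      filter_upwards [eventually_ge_atTop Q₀, eventually_ge_atTop 1] with Q hQ hQ1
      rintro x ⟨hx, hxR⟩
      obtain ⟨p, q, hq, hqQ, hlt⟩ := exists_ratPt_of_mem_approximableSet hx Q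
      obtain ⟨k, rfl⟩ := Nat.exists_eq_add_of_le' hqQ
      have h1 : ‖x - ratPt p (k + Q)‖ ≤ ((k + Q : ℕ) : ℝ) ^ (-τ) := hlt.le.trans (hQ₀ _ (by omega))
      have hq1 : (1 : ℝ) ≤ ((k + Q : ℕ) : ℝ) := by exact_mod_cast hq
      have h2 : ((k + Q : ℕ) : ℝ) ^ (-τ) ≤ 1 :=
        Real.rpow_le_one_of_one_le_of_nonpos hq1 (neg_nonpos.2 hτ0.le)
      refine mem_iUnion.2 ⟨(k, p), ?_⟩
      have hp : p ∈ I (k + Q) := by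
        have h3 : ∀ i, |p i| ≤ (((R + 1) * (k + Q) : ℕ) : ℤ) := by
          intro i
          have h4 : ‖ratPt p (k + Q)‖ ≤ R + 1 := by
            calc ‖ratPt p (k + Q)‖ = ‖x - (x - ratPt p (k + Q))‖ := by congr 1; abel
              _ ≤ ‖x‖ + ‖x - ratPt p (k + Q)‖ := norm_sub_le _ _
              _ ≤ R + 1 := add_le_add hxR (h1.trans h2)
          have h5 := (norm_le_pi_norm (ratPt p (k + Q)) i).trans h4
          rw [ratPt, Real.norm_eq_abs, abs_div, Nat.abs_cast, div_le_iff₀ (by linarith)] at h5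
          exact_mod_cast h5
        simp only [hI, Finset.mem_Icc, Pi.le_def]
        exact ⟨fun i => (abs_le.1 (h3 i)).1, fun i => (abs_le.1 (h3 i)).2⟩
      simp only [hU, hp, if_true]
      rwa [Metric.mem_closedBall, dist_eq_norm]
  rw [nonpos_iff_eq_zero.1 hzero]
  exact ENNReal.zero_ne_top

/-! ### Target denominators and radii -/

/-- A positive function that is infinitely often at least `Q ^ (-τ)` is so at infinitely many `Q` at
which it has moreover controlled decay just before `Q`. -/
theorem frequently_controlled_decay {ψ : ℕ → ℝ} (hpos : ∀ s : ℕ, 1 ≤ s → 0 < ψ s) {A τ : ℝ}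
    (hτ : 0 < τ) (h : ∃ᶠ Q : ℕ in atTop, (Q : ℝ) ^ (-τ) < ψ Q) :
    ∃ᶠ Q : ℕ in atTop, 1 ≤ Q ∧ (Q : ℝ) ^ (-τ) ≤ ψ Q ∧
      ∀ q : ℕ, 1 ≤ q → q ≤ Q → (Q : ℝ) ≤ A * q → ψ q ≤ A ^ (τ + 1) * ψ Q := by
  rw [frequently_atTop]
  intro a
  -- `Q` maximises `g` on `[1, Q']`, which gives the controlled decay. The extra 1 in the exponent
  -- makes `g Q' ≥ Q'` unbounded, so the maximiser escapes to infinity.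
  set g : ℕ → ℝ := fun q => (q : ℝ) ^ (τ + 1) * ψ q with hg
  have hg0 : ∀ q, 1 ≤ q → 0 < g q := fun q hq => by
    have := hpos q hq
    have : (0 : ℝ) < q := by exact_mod_cast hq
    positivity
  obtain ⟨T, hT⟩ := exists_nat_gt (∑ q ∈ Finset.Ico 1 a, g q)
  obtain ⟨Q', hQ'T, hQ'⟩ := frequently_atTop.1 h (max T 1)
  have hQ'1 : 1 ≤ Q' := (le_max_right _ _).trans hQ'T
  have hQ'0 : (0 : ℝ) < Q' := by exact_mod_cast hQ'1
  obtain ⟨Q, hQmem, hmax⟩ := Finset.exists_max_image (Finset.Icc 1 Q') g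
    ⟨1, Finset.mem_Icc.2 ⟨le_rfl, hQ'1⟩⟩
  obtain ⟨hQ1, hQQ'⟩ := Finset.mem_Icc.1 hQmem
  have hQ0 : (0 : ℝ) < Q := by exact_mod_cast hQ1
  have hgQ' : (Q' : ℝ) ≤ g Q' := by
    calc (Q' : ℝ) = (Q' : ℝ) ^ (τ + 1) * (Q' : ℝ) ^ (-τ) := by
          rw [← Real.rpow_add hQ'0]; simp
      _ ≤ g Q' := mul_le_mul_of_nonneg_left hQ'.le (by positivity)
  have hgQ : (Q' : ℝ) ≤ g Q := hgQ'.trans (hmax Q' (Finset.mem_Icc.2 ⟨hQ'1, le_rfl⟩))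
  refine ⟨Q, ?_, hQ1, ?_, ?_⟩
  · by_contra hlt
    have h1 : g Q ≤ ∑ q ∈ Finset.Ico 1 a, g q :=
      Finset.single_le_sum (f := g) (fun q hq => (hg0 q (Finset.mem_Ico.1 hq).1).le)
        (Finset.mem_Ico.2 ⟨hQ1, by omega⟩)
    have h2 : (T : ℝ) ≤ Q' := by exact_mod_cast (le_max_left _ _).trans hQ'T
    linarith
  · have h1 : (Q : ℝ) ≤ g Q := le_trans (by exact_mod_cast hQQ') hgQ
    have h2 : (Q : ℝ) = (Q : ℝ) ^ (τ + 1) * (Q : ℝ) ^ (-τ) := by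
      rw [← Real.rpow_add hQ0]; simp
    refine le_of_mul_le_mul_left (a := (Q : ℝ) ^ (τ + 1)) ?_ (by positivity)
    rw [← h2]
    exact h1
  · intro q hq hqQ hQA
    have hq0 : (0 : ℝ) < q := by exact_mod_cast hq
    have h1 : g q ≤ g Q := hmax q (Finset.mem_Icc.2 ⟨hq, hqQ.trans hQQ'⟩)
    have hA0 : 0 < A := by
      by_contra hA
      have : A * q ≤ 0 := mul_nonpos_of_nonpos_of_nonneg (not_lt.1 hA) hq0.le
      linarith
    have hψQ := hpos Q hQ1
    refine le_of_mul_le_mul_left (a := (q : ℝ) ^ (τ + 1)) ?_ (by positivity)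
    calc (q : ℝ) ^ (τ + 1) * ψ q ≤ (Q : ℝ) ^ (τ + 1) * ψ Q := h1
      _ ≤ (A * q) ^ (τ + 1) * ψ Q := by gcongr
      _ = (q : ℝ) ^ (τ + 1) * (A ^ (τ + 1) * ψ Q) := by
        rw [Real.mul_rpow hA0.le hq0.le]; ring

/-- The radii of the cubes in the construction: they are divided by `M` at each step, except that
they drop to `ψ Q / 4` when they become comparable with `Q ^ (-(n + 1) / n)`, where the target
denominator `Q = Q_r` depends on the radius `r` after the last drop. -/
theorem exists_scales {n : ℕ} {ψ : ℕ → ℝ} {Qf : ℝ → ℕ} {M K N σ s : ℝ} (hM : 1 < M)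
    (hNM : M ^ σ ≤ N) (hs : 0 < s) (hsσ : s ≤ σ)
    (hQK : ∀ r, 0 < r → r ≤ 1 → K < (Qf r : ℝ) ^ (n + 1) * r ^ n)
    (hψ : ∀ r, 0 < r → r ≤ 1 → 0 < ψ (Qf r))
    (hψu : ∀ r u, 0 < r → r ≤ 1 → 0 < u → K / M ^ n ≤ (Qf r : ℝ) ^ (n + 1) * u ^ n →
      ψ (Qf r) / 4 ≤ u)
    (hmass : ∀ r u, 0 < r → r ≤ 1 → 0 < u → (Qf r : ℝ) ^ (n + 1) * u ^ n ≤ K →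
      (u / r) ^ σ ≤ (ψ (Qf r) / 4) ^ s) :
    ∃ r ρ : ℕ → ℝ, ρ 0 = 1 ∧ ∀ m, 0 < ρ m ∧ ρ m ≤ r m ∧ r m ≤ 1 ∧ ρ (m + 1) ≤ ρ m / M ∧
      (N ^ m)⁻¹ ≤ ρ m ^ s ∧ K < (Qf (r m) : ℝ) ^ (n + 1) * ρ m ^ n ∧
      ((Qf (r m) : ℝ) ^ (n + 1) * (ρ m / M) ^ n ≤ K →
        r (m + 1) = ψ (Qf (r m)) / 4 ∧ ρ (m + 1) = ψ (Qf (r m)) / 4) ∧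
      (K < (Qf (r m) : ℝ) ^ (n + 1) * (ρ m / M) ^ n → r (m + 1) = r m ∧ ρ (m + 1) = ρ m / M) := by
  classical
  have hM0 : 0 < M := by linarith
  have hσ : 0 < σ := hs.trans_le hsσ
  have hN0 : 0 < N := lt_of_lt_of_le (by positivity) hNM
  let S : ℕ → ℝ × ℝ := fun m => Nat.rec (1, 1) (fun _ st =>
    if (Qf st.1 : ℝ) ^ (n + 1) * (st.2 / M) ^ n ≤ K then (ψ (Qf st.1) / 4, ψ (Qf st.1) / 4)
    else (st.1, st.2 / M)) m
  set r : ℕ → ℝ := fun m => (S m).1 with hr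
  set ρ : ℕ → ℝ := fun m => (S m).2 with hρ
  have hjump : ∀ m, (Qf (r m) : ℝ) ^ (n + 1) * (ρ m / M) ^ n ≤ K →
      r (m + 1) = ψ (Qf (r m)) / 4 ∧ ρ (m + 1) = ψ (Qf (r m)) / 4 := by
    intro m h
    have : S (m + 1) = (ψ (Qf (r m)) / 4, ψ (Qf (r m)) / 4) := if_pos h
    simp only [hr, hρ, this, and_self]
  have hstay : ∀ m, K < (Qf (r m) : ℝ) ^ (n + 1) * (ρ m / M) ^ n →
      r (m + 1) = r m ∧ ρ (m + 1) = ρ m / M := by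
    intro m h
    have : S (m + 1) = (r m, ρ m / M) := if_neg (not_le.2 h)
    constructor
    · change (S (m + 1)).1 = _
      rw [this]
    · change (S (m + 1)).2 = _
      rw [this]
  -- The bound with `σ` is relative to the last drop and pays for the next one through `hmass`; it
  -- restarts trivially after a drop, where `ρ = r`.
  have hinv : ∀ m, 0 < ρ m ∧ ρ m ≤ r m ∧ r m ≤ 1 ∧ (N ^ m)⁻¹ * r m ^ σ ≤ ρ m ^ σ ∧
      (N ^ m)⁻¹ ≤ ρ m ^ s ∧ K < (Qf (r m) : ℝ) ^ (n + 1) * ρ m ^ n := by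
    intro m
    induction m with
    | zero =>
      have h1 : r 0 = 1 := rfl
      have h2 : ρ 0 = 1 := rfl
      have h3 := hQK 1 one_pos le_rfl
      simp [h1, h2]
      simpa using h3
    | succ m ih =>
      obtain ⟨i1, i2, i3, i4, i5, i6⟩ := ih
      have hr0 : 0 < r m := i1.trans_le i2
      have hu0 : 0 < ρ m / M := by positivity
      have hlow : K / M ^ n < (Qf (r m) : ℝ) ^ (n + 1) * (ρ m / M) ^ n := by
        rw [div_pow, ← mul_div_assoc]; gcongr
      have hsucc : ∀ t, 0 < t → t ≤ σ → (N ^ m)⁻¹ ≤ ρ m ^ t → (N ^ (m + 1))⁻¹ ≤ (ρ m / M) ^ t := by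
        intro t ht0 ht h
        have : M ^ t ≤ N := (Real.rpow_le_rpow_of_exponent_le hM.le ht).trans hNM
        rw [Real.div_rpow i1.le hM0.le, pow_succ, mul_inv, div_eq_mul_inv]
        gcongr
      have hmulr : (N ^ (m + 1))⁻¹ * r m ^ σ ≤ (ρ m / M) ^ σ := by
        rw [Real.div_rpow i1.le hM0.le, pow_succ, mul_inv, div_eq_mul_inv]
        calc (N ^ m)⁻¹ * N⁻¹ * r m ^ σ = ((N ^ m)⁻¹ * r m ^ σ) * N⁻¹ := by ring
          _ ≤ ρ m ^ σ * (M ^ σ)⁻¹ := by gcongr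
      rcases le_or_gt ((Qf (r m) : ℝ) ^ (n + 1) * (ρ m / M) ^ n) K with h | h
      · obtain ⟨e1, e2⟩ := hjump m h
        have hψ0 := hψ (r m) hr0 i3
        have h1 := hψu (r m) (ρ m / M) hr0 i3 hu0 hlow.le
        have h2 := hmass (r m) (ρ m / M) hr0 i3 hu0 h
        have hρM : ρ m / M ≤ ρ m := div_le_self i1.le hM.le
        have hle1 : ψ (Qf (r m)) / 4 ≤ 1 := by linarith
        have hNm : (N ^ (m + 1))⁻¹ ≤ (ρ m / M / r m) ^ σ := by
          rw [Real.div_rpow hu0.le hr0.le, le_div_iff₀ (by positivity)]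
          exact hmulr
        have hN1 : (N ^ (m + 1))⁻¹ ≤ 1 := by
          refine inv_le_one_of_one_le₀ (one_le_pow₀ ?_)
          exact (Real.one_le_rpow hM.le hσ.le).trans hNM
        rw [e1, e2]
        refine ⟨by positivity, le_rfl, hle1, ?_, hNm.trans h2, ?_⟩
        · exact mul_le_of_le_one_left (by positivity) hN1
        · exact hQK _ (by positivity) hle1
      · obtain ⟨e1, e2⟩ := hstay m h
        rw [e1, e2]
        exact ⟨hu0, (div_le_self i1.le hM.le).trans i2, i3, hmulr, hsucc s hs hsσ i5, h⟩
  refine ⟨r, ρ, rfl, fun m => ?_⟩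
  obtain ⟨i1, i2, i3, i4, i5, i6⟩ := hinv m
  refine ⟨i1, i2, i3, ?_, i5, i6, hjump m, hstay m⟩
  have hr0 : 0 < r m := i1.trans_le i2
  have hu0 : 0 < ρ m / M := by positivity
  rcases le_or_gt ((Qf (r m) : ℝ) ^ (n + 1) * (ρ m / M) ^ n) K with h | h
  · rw [(hjump m h).2]
    refine hψu (r m) (ρ m / M) hr0 i3 hu0 ?_
    rw [div_pow, ← mul_div_assoc]; gcongr
  · rw [(hstay m h).2]

/-! ### Inheritance of goodness and membership in the limit set -/

/-- Only denominators in the new window need an argument: there badness implies the `c' * ψ` bound,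
since `q ^ (n + 1) * ψ q ^ n` is bounded and `c'` is small. -/
theorem GoodCube.child {n : ℕ} {ψ : ℕ → ℝ} {c c' θ r ρ h B : ℝ} {x x' : Fin n → ℝ} (hn : 1 ≤ n)
    (hB : ∀ q : ℕ, 1 ≤ q → (q : ℝ) ^ (n + 1) * ψ q ^ n ≤ B)
    (hc'0 : 0 < c') (hc'B : c' ^ n * B ≤ c) (hx : GoodCube ψ c c' θ r x ρ)
    (hsub : ‖x' - x‖ + h ≤ ρ)
    (hbad : ∀ y, ‖y - x'‖ ≤ h → ∀ (p : Fin n → ℤ) (q : ℕ), 1 ≤ q → (q : ℝ) ^ (n + 1) * h ^ n < θ →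
      θ ≤ (q : ℝ) ^ (n + 1) * ρ ^ n → c ≤ (q : ℝ) ^ (n + 1) * ‖y - ratPt p q‖ ^ n) :
    GoodCube ψ c c' θ r x' h := by
  intro y hy p q hq hqh
  have hyx : ‖y - x‖ ≤ ρ := by
    calc ‖y - x‖ = ‖(y - x') + (x' - x)‖ := by congr 1; abel
      _ ≤ ‖y - x'‖ + ‖x' - x‖ := norm_add_le _ _
      _ ≤ ρ := by linarith
  rcases lt_or_ge ((q : ℝ) ^ (n + 1) * ρ ^ n) θ with h1 | h1
  · exact hx y hyx p q hq h1
  · have h2 := hbad y hy p q hq hqh h1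
    have hq0 : (0 : ℝ) < q := by exact_mod_cast hq
    refine ⟨?_, fun _ => h2⟩
    refine le_of_pow_le_pow_left₀ (by omega : n ≠ 0) (norm_nonneg _) ?_
    refine le_of_mul_le_mul_left (a := (q : ℝ) ^ (n + 1)) ?_ (by positivity)
    calc (q : ℝ) ^ (n + 1) * (c' * ψ q) ^ n = c' ^ n * ((q : ℝ) ^ (n + 1) * ψ q ^ n) := by ring
      _ ≤ c' ^ n * B := by gcongr; exact hB q hq
      _ ≤ _ := hc'B.trans h2

/-- Positive, arbitrarily small distances force infinitely many distinct rational points, as a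
finite set of positive distances has a positive minimum. -/
theorem mem_badlyApproximableSet {n : ℕ} {ψ : ℕ → ℝ} {c' : ℝ} (hc' : 0 < c') {w : Fin n → ℝ}
    (hfar : ∀ (p : Fin n → ℤ) (q : ℕ), 1 ≤ q → c' * ψ q ≤ ‖w - ratPt p q‖)
    (hnear : ∀ ε > 0, ∃ (p : Fin n → ℤ) (q : ℕ), 1 ≤ q ∧ 0 < ‖w - ratPt p q‖ ∧
      ‖w - ratPt p q‖ < ψ q ∧ ‖w - ratPt p q‖ < ε) :
    w ∈ badlyApproximableSet n ψ := by
  constructor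
  · intro hfin
    set V := {v : Fin n → ℚ | ∃ (q : ℕ) (p : Fin n → ℤ), 1 ≤ q ∧
      (∀ i, v i = (p i : ℚ) / (q : ℚ)) ∧ ‖w - fun i => (p i : ℝ) / (q : ℝ)‖ < ψ q} with hV
    set T : Set ℝ := (fun v : Fin n → ℚ => ‖w - fun i => (v i : ℝ)‖) '' V ∩ Set.Ioi 0 with hT
    have hTfin : T.Finite := (Set.Finite.image _ hfin).inter_of_left _
    obtain ⟨ε, hε, hεT⟩ : ∃ ε > 0, ∀ t ∈ T, ε ≤ t := by
      rcases T.eq_empty_or_nonempty with h | h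
      · exact ⟨1, one_pos, by simp [h]⟩
      · obtain ⟨t, ht, hmin⟩ := Set.exists_min_image T id hTfin h
        exact ⟨t, ht.2, hmin⟩
    obtain ⟨p, q, hq, h0, h1, h2⟩ := hnear ε hε
    have hmem : ‖w - ratPt p q‖ ∈ T := by
      refine ⟨⟨fun i => (p i : ℚ) / (q : ℚ), ⟨q, p, hq, fun _ => rfl, h1⟩, ?_⟩, h0⟩
      simp only [Rat.cast_div, Rat.cast_intCast, Rat.cast_natCast]
      rfl
    exact absurd (hεT _ hmem) (not_le.2 h2)
  · intro hmem
    simp only [mem_iInter] at hmem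
    obtain ⟨p, q, hq, -, hlt⟩ := exists_ratPt_of_mem_approximableSet (hmem c' hc') 0
    exact absurd (hfar p q hq) (not_le.2 hlt)

/-! ### Choice of the constants -/

theorem tendsto_pow_mul_pow {n : ℕ} (hn : 1 ≤ n) {ψ : ℕ → ℝ}
    (hlittle : Asymptotics.IsLittleO Filter.atTop ψ
      (fun s : ℕ => (s : ℝ) ^ (-(((n : ℝ) + 1) / (n : ℝ))))) :
    Tendsto (fun q : ℕ => (q : ℝ) ^ (n + 1) * ψ q ^ n) atTop (𝓝 0) := by
  have h := (hlittle.tendsto_div_nhds_zero).pow n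
  rw [zero_pow (by omega)] at h
  refine h.congr' ?_
  filter_upwards [eventually_ge_atTop 1] with q hq
  have hq0 : (0 : ℝ) < q := by exact_mod_cast hq
  have hn0 : (n : ℝ) ≠ 0 := by exact_mod_cast (by omega : n ≠ 0)
  have : ((q : ℝ) ^ (-(((n : ℝ) + 1) / (n : ℝ)))) ^ n = ((q : ℝ) ^ (n + 1))⁻¹ := by
    rw [← Real.rpow_natCast, ← Real.rpow_mul hq0.le, ← Real.rpow_natCast (q : ℝ) (n + 1),
      ← Real.rpow_neg hq0.le]
    congr 1
    push_cast
    field_simp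
  rw [div_pow, this, div_inv_eq_mul, mul_comm]

/-- The loss `20 * n` per step is fixed while `L ^ (n - σ)` tends to infinity, so every dimension `σ
< n` is reached. -/
theorem exists_branching {n : ℕ} (hn : 1 ≤ n) {σ : ℝ} (hσn : σ < n) :
    ∃ L : ℕ, 2 ≤ L ∧ (20 * n * L : ℝ) ^ σ ≤ (L : ℝ) ^ n := by
  have h1 : Tendsto (fun L : ℕ => (L : ℝ) ^ ((n : ℝ) - σ)) atTop atTop :=
    (tendsto_rpow_atTop (by linarith)).comp tendsto_natCast_atTop_atTop
  obtain ⟨L, hL, hL2⟩ := ((h1.eventually_ge_atTop ((20 * n : ℝ) ^ σ)).and (eventually_ge_atTop 2)).exists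
  refine ⟨L, hL2, ?_⟩
  have hL0 : (0 : ℝ) < L := by exact_mod_cast (by omega : 0 < L)
  calc (20 * n * L : ℝ) ^ σ = (20 * n : ℝ) ^ σ * (L : ℝ) ^ σ := Real.mul_rpow (by positivity) hL0.le
    _ ≤ (L : ℝ) ^ ((n : ℝ) - σ) * (L : ℝ) ^ σ := by gcongr
    _ = (L : ℝ) ^ n := by rw [← Real.rpow_add hL0, sub_add_cancel, Real.rpow_natCast]

theorem exists_small_constant {n : ℕ} (hn : 1 ≤ n) {a b k₁ k₂ K' : ℝ} (ha : 0 < a) (hb : 0 < b) :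
    ∃ c' : ℝ, 0 < c' ∧ c' ≤ 1 / 4 ∧ c' * K' ≤ 1 / 4 ∧ (2 * c') ^ n * k₁ ≤ a ∧ c' ^ n * k₂ ≤ b := by
  have ev : ∀ f : ℝ → ℝ, Continuous f → f 0 = 0 → ∀ t > 0, ∀ᶠ x in 𝓝[>] (0 : ℝ), f x ≤ t := by
    intro f hf h0 t ht
    have h1 : Tendsto f (𝓝 0) (𝓝 0) := by simpa [h0] using hf.tendsto 0
    exact ((h1.mono_left nhdsWithin_le_nhds).eventually (gt_mem_nhds ht)).mono fun _ h => h.le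
  have hn0 : n ≠ 0 := by omega
  have h := (ev (fun x => x) (by fun_prop) rfl (1 / 4) (by norm_num)).and
    ((ev (fun x => x * K') (by fun_prop) (by simp) (1 / 4) (by norm_num)).and
    ((ev (fun x => (2 * x) ^ n * k₁) (by fun_prop) (by simp [hn0]) a ha).and
    ((ev (fun x => x ^ n * k₂) (by fun_prop) (by simp [hn0]) b hb).and
      (eventually_mem_nhdsWithin (a := (0 : ℝ)) (s := Ioi 0)))))
  obtain ⟨c', h1, h2, h3, h4, h5⟩ := h.exists
  exact ⟨c', h5, h1, h2, h3, h4⟩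

/-- For fixed `r` only finitely many `q` are concerned. The gap lets the next `Q` be so large that
Dirichlet's point avoids these denominators. -/
theorem exists_uniform_gap {n : ℕ} {ψ : ℕ → ℝ} (hpos : ∀ s : ℕ, 1 ≤ s → 0 < ψ s)
    (hmono : AntitoneOn ψ (Set.Ici 1)) {c' θ r : ℝ} (hc' : 0 < c') (hr : 0 < r) :
    ∃ η > 0, ∀ q : ℕ, 1 ≤ q → (q : ℝ) ^ (n + 1) * r ^ n < θ → η ≤ c' * ψ q := by
  obtain ⟨T, hT⟩ := exists_nat_ge (θ / r ^ n)
  refine ⟨c' * ψ (T + 1), mul_pos hc' (hpos _ (by omega)), fun q hq h => ?_⟩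
  have hq1 : (1 : ℝ) ≤ q := by exact_mod_cast hq
  have h1 : (q : ℝ) ≤ T := by
    calc (q : ℝ) ≤ (q : ℝ) ^ (n + 1) := le_self_pow₀ hq1 (by omega)
      _ ≤ θ / r ^ n := by rw [le_div_iff₀ (by positivity)]; exact h.le
      _ ≤ T := hT
  have h2 : q ≤ T := by exact_mod_cast h1
  have h3 : ψ (T + 1) ≤ ψ q := hmono (mem_Ici.2 hq) (mem_Ici.2 (by omega)) (by omega)
  gcongr

/-- Here `u ^ σ` is at most a constant times `Q ^ (-σ(n+1)/n)` and `ψ Q ^ s` at least `Q ^ (-sτ)`;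
the spare power `Q ^ β` absorbs `K`, `r` and 4. -/
theorem eventually_mass_bound {n : ℕ} (hn : 1 ≤ n) {ψ : ℕ → ℝ} {K r s σ τ : ℝ} (hK : 0 < K)
    (hr : 0 < r) (hs : 0 < s) (hσ : 0 < σ) (hστ : s * τ < σ * ((n : ℝ) + 1) / n) :
    ∀ᶠ Q : ℕ in atTop, (Q : ℝ) ^ (-τ) ≤ ψ Q → ∀ u, 0 < u → (Q : ℝ) ^ (n + 1) * u ^ n ≤ K →
      (u / r) ^ σ ≤ (ψ Q / 4) ^ s := by
  have hn0 : (0 : ℝ) < n := by exact_mod_cast hn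
  set β : ℝ := σ * ((n : ℝ) + 1) / n - s * τ with hβ
  have h1 : Tendsto (fun Q : ℕ => (Q : ℝ) ^ β) atTop atTop :=
    (tendsto_rpow_atTop (by linarith)).comp tendsto_natCast_atTop_atTop
  filter_upwards [h1.eventually_ge_atTop (K ^ (σ / n) / r ^ σ * 4 ^ s), eventually_ge_atTop 1]
    with Q hQ hQ1 hψ u hu huK
  have hQ0 : (0 : ℝ) < Q := by exact_mod_cast hQ1
  have h2 : u ^ σ ≤ K ^ (σ / n) * (Q : ℝ) ^ (-(σ * ((n : ℝ) + 1) / n)) := by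
    have e1 : u ^ σ = (u ^ n) ^ (σ / n) := by
      rw [← Real.rpow_natCast, ← Real.rpow_mul hu.le]; congr 1; field_simp
    have e2 : (Q : ℝ) ^ (-(σ * ((n : ℝ) + 1) / n)) = (((Q : ℝ) ^ (n + 1))⁻¹) ^ (σ / n) := by
      rw [← Real.rpow_natCast, ← Real.rpow_neg hQ0.le, ← Real.rpow_mul hQ0.le]
      congr 1
      push_cast
      ring
    rw [e1, e2, ← Real.mul_rpow hK.le (by positivity)]
    refine Real.rpow_le_rpow (by positivity) ?_ (by positivity)
    rw [← div_eq_mul_inv, le_div_iff₀ (by positivity), mul_comm]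
    exact huK
  have h3 : ((Q : ℝ) ^ (-τ) / 4) ^ s ≤ (ψ Q / 4) ^ s := by gcongr
  refine le_trans ?_ h3
  have e3 : ((Q : ℝ) ^ (-τ) / 4) ^ s = (Q : ℝ) ^ (-(s * τ)) / 4 ^ s := by
    rw [Real.div_rpow (by positivity) (by norm_num), ← Real.rpow_mul hQ0.le]
    congr 2; ring
  have e4 : (Q : ℝ) ^ (-(σ * ((n : ℝ) + 1) / n)) * (Q : ℝ) ^ β = (Q : ℝ) ^ (-(s * τ)) := by
    rw [← Real.rpow_add hQ0]; congr 1; rw [hβ]; ring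
  rw [e3, le_div_iff₀ (by positivity), Real.div_rpow hu.le hr.le]
  calc u ^ σ / r ^ σ * 4 ^ s
      ≤ K ^ (σ / n) * (Q : ℝ) ^ (-(σ * ((n : ℝ) + 1) / n)) / r ^ σ * 4 ^ s := by gcongr
    _ = (Q : ℝ) ^ (-(σ * ((n : ℝ) + 1) / n)) * (K ^ (σ / n) / r ^ σ * 4 ^ s) := by ring
    _ ≤ (Q : ℝ) ^ (-(σ * ((n : ℝ) + 1) / n)) * (Q : ℝ) ^ β := by gcongr
    _ = _ := e4

/-! ### The Cantor set and the theorem -/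

set_option maxHeartbeats 1000000 in
/-- If `ψ` is infinitely often at least `Q ^ (-(n + 1) / s₁)`, then the `ψ`-badly approximable points
have Hausdorff dimension at least `s` for every `s < s₁`. -/
theorem le_dimH_badlyApproximableSet {n : ℕ} (hn : 1 ≤ n) {ψ : ℕ → ℝ}
    (hpos : ∀ s : ℕ, 1 ≤ s → 0 < ψ s) (hmono : AntitoneOn ψ (Set.Ici 1))
    (hlittle : Asymptotics.IsLittleO Filter.atTop ψ
      (fun s : ℕ => (s : ℝ) ^ (-(((n : ℝ) + 1) / (n : ℝ)))))
    {s₁ : ℝ} {s : ℝ≥0} (hs : 0 < s) (hss₁ : (s : ℝ) < s₁) (hs₁n : s₁ ≤ n)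
    (hfreq : ∃ᶠ Q : ℕ in atTop, (Q : ℝ) ^ (-(((n : ℝ) + 1) / s₁)) < ψ Q) :
    (s : ℝ≥0∞) ≤ dimH (badlyApproximableSet n ψ) := by
  have hn0 : (0 : ℝ) < n := by exact_mod_cast hn
  have hs0 : (0 : ℝ) < s := by exact_mod_cast hs
  have hs₁0 : 0 < s₁ := hs0.trans hss₁
  set τ : ℝ := ((n : ℝ) + 1) / s₁ with hτ
  have hτ0 : 0 < τ := by positivity
  -- the exponent `σ`
  have hsn : s * n / s₁ < n := by rw [div_lt_iff₀ hs₁0]; nlinarith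
  obtain ⟨σ, hσ1, hσn⟩ := exists_between hsn
  have hsσ : (s : ℝ) ≤ σ := by
    refine le_trans ?_ hσ1.le
    rw [le_div_iff₀ hs₁0]
    gcongr
  have hσ0 : 0 < σ := hs0.trans_le hsσ
  have hστ : s * τ < σ * ((n : ℝ) + 1) / n := by
    rw [div_lt_iff₀ hs₁0] at hσ1
    rw [hτ, ← mul_div_assoc, div_lt_div_iff₀ hs₁0 hn0]
    have : (0 : ℝ) < n + 1 := by positivity
    nlinarith
  -- the constants
  obtain ⟨L, hL2, hL⟩ := exists_branching hn hσn
  have hL1 : 1 ≤ L := by omega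
  have hL' : (1 : ℝ) ≤ L := by exact_mod_cast hL1
  have hn' : (1 : ℝ) ≤ n := by exact_mod_cast hn
  obtain ⟨M, hM⟩ : ∃ M : ℝ, M = 20 * n * L := ⟨_, rfl⟩
  rw [← hM] at hL
  have hM20 : 20 ≤ M := by rw [hM]; nlinarith
  have hM0 : 0 < M := by linarith
  obtain ⟨θ, hθ⟩ : ∃ θ : ℝ, θ = 1 / (M ^ n * (2 ^ n * (n + 1)!)) := ⟨_, rfl⟩
  have hθ0 : 0 < θ := by rw [hθ]; positivity
  have hMn1 : 1 ≤ M ^ n := one_le_pow₀ (by linarith)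
  have hθ1 : θ ≤ 1 := by
    have h2 : (1 : ℝ) ≤ 2 ^ n := one_le_pow₀ (by norm_num)
    have h3 : (1 : ℝ) ≤ (n + 1)! := by exact_mod_cast Nat.one_le_iff_ne_zero.2 (Nat.factorial_ne_zero _)
    rw [hθ, div_le_one (by positivity)]
    exact one_le_mul_of_one_le_of_one_le hMn1 (one_le_mul_of_one_le_of_one_le h2 h3)
  obtain ⟨c, hc⟩ : ∃ c : ℝ, c = θ / M ^ n := ⟨_, rfl⟩
  have hc0 : 0 < c := by rw [hc]; positivity
  have hc1 : c ≤ 1 := by rw [hc, div_le_one (by positivity)]; exact hθ1.trans hMn1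
  obtain ⟨A, hA⟩ : ∃ A : ℝ, A = 2 ^ n / c := ⟨_, rfl⟩
  have hA0 : 0 < A := by rw [hA]; positivity
  have hA1 : 1 ≤ A := by
    rw [hA, le_div_iff₀ hc0, one_mul]; exact hc1.trans (one_le_pow₀ (by norm_num))
  obtain ⟨N, hN⟩ := exists_nat_ge (4 / c)
  have hN0 : (0 : ℝ) < N := lt_of_lt_of_le (by positivity) hN
  have hN1 : 1 ≤ N := by exact_mod_cast hN0
  obtain ⟨d, hd⟩ : ∃ d : ℝ, d = c / (8 * N) := ⟨_, rfl⟩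
  have hd0 : 0 < d := by rw [hd]; positivity
  have hNd : 2 / N + 2 * N * d < c := by
    have h1 : 2 / (N : ℝ) ≤ c / 2 := by
      rw [div_le_iff₀ hc0] at hN
      rw [div_le_div_iff₀ hN0 two_pos]
      linarith
    have h2 : 2 * N * d = c / 4 := by rw [hd]; field_simp; norm_num
    linarith
  obtain ⟨e, he⟩ : ∃ e : ℝ, e = min 1 (d ^ (n + 1) / 8 ^ (n + 1)) := ⟨_, rfl⟩
  have he0 : 0 < e := by rw [he]; positivity
  have he1 : e ≤ 1 := by rw [he]; exact min_le_left _ _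
  have hed : 8 ^ (n + 1) * e ≤ d ^ (n + 1) := by
    have : e ≤ d ^ (n + 1) / 8 ^ (n + 1) := by rw [he]; exact min_le_right _ _
    rwa [le_div_iff₀ (by positivity), mul_comm] at this
  have hlim := tendsto_pow_mul_pow hn hlittle
  obtain ⟨B, hB'⟩ := hlim.bddAbove_range
  have hB : ∀ q : ℕ, 1 ≤ q → (q : ℝ) ^ (n + 1) * ψ q ^ n ≤ B := fun q _ => hB' ⟨q, rfl⟩
  -- When `Q ^ (n + 1) * (ρ / M) ^ n` first falls to `K` or below, it still exceeds `K / M ^ n = 8 ^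
  -- n * A ^ n`, as the jump requires.
  obtain ⟨K, hK⟩ : ∃ K : ℝ, K = 8 ^ n * A ^ n * M ^ n := ⟨_, rfl⟩
  have h8A : (1 : ℝ) ≤ 8 ^ n * A ^ n :=
    one_le_mul_of_one_le_of_one_le (one_le_pow₀ (by norm_num)) (one_le_pow₀ hA1)
  have hK1 : 1 ≤ K := by rw [hK]; exact one_le_mul_of_one_le_of_one_le h8A hMn1
  have hKM : K / M ^ n = 8 ^ n * A ^ n := by rw [hK]; field_simp
  obtain ⟨c', hc'0, hc'1, hc'K, hc'B, hc'B2⟩ := exists_small_constant hn (k₁ := B * (K / θ))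
    (k₂ := B) (K' := A ^ (τ + 1)) (pow_pos hd0 n) hc0
  -- the target denominators
  have hQex : ∀ r : ℝ, ∃ Q : ℕ, 0 < r → r ≤ 1 →
      1 ≤ Q ∧ (∀ q : ℕ, 1 ≤ q → q ≤ Q → (Q : ℝ) ≤ A * q → ψ q ≤ A ^ (τ + 1) * ψ Q) ∧
      K < (Q : ℝ) ^ (n + 1) * r ^ n ∧ (Q : ℝ) ^ (n + 1) * ψ Q ^ n ≤ e ^ n ∧
      (∃ η > 0, (∀ q : ℕ, 1 ≤ q → (q : ℝ) ^ (n + 1) * r ^ n < θ → η ≤ c' * ψ q) ∧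
        2 ^ n < Q * η ^ n) ∧
      ∀ u, 0 < u → (Q : ℝ) ^ (n + 1) * u ^ n ≤ K → (u / r) ^ σ ≤ (ψ Q / 4) ^ (s : ℝ) := by
    intro r
    by_cases hr : 0 < r
    · obtain ⟨η, hη0, hη⟩ := exists_uniform_gap (n := n) (θ := θ) hpos hmono hc'0 hr
      have hcast : Tendsto (fun Q : ℕ => (Q : ℝ)) atTop atTop := tendsto_natCast_atTop_atTop
      have e1 : ∀ᶠ Q : ℕ in atTop, K < (Q : ℝ) ^ (n + 1) * r ^ n :=
        (((tendsto_pow_atTop (by omega)).comp hcast).atTop_mul_const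
          (pow_pos hr n)).eventually_gt_atTop K
      have e2 : ∀ᶠ Q : ℕ in atTop, 2 ^ n < (Q : ℝ) * η ^ n :=
        (hcast.atTop_mul_const (pow_pos hη0 n)).eventually_gt_atTop _
      have e3 : ∀ᶠ Q : ℕ in atTop, (Q : ℝ) ^ (n + 1) * ψ Q ^ n ≤ e ^ n :=
        (hlim.eventually (gt_mem_nhds (pow_pos he0 n))).mono fun _ h => h.le
      have e4 := eventually_mass_bound hn (ψ := ψ) (K := K) (by linarith) hr hs0 hσ0 hστ
      obtain ⟨Q, ⟨h1, h2, h3⟩, h4, h5, h6, h7⟩ := ((frequently_controlled_decay (A := A) hpos hτ0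
        hfreq).and_eventually (e1.and (e2.and (e3.and e4)))).exists
      exact ⟨Q, fun _ _ => ⟨h1, h3, h4, h6, ⟨η, hη0, hη, h5⟩, h7 h2⟩⟩
    · exact ⟨0, fun h => absurd h hr⟩
  choose Qf hQf using hQex
  have hcardD : Fintype.card (Fin n → Fin L) = L ^ n := by simp
  obtain ⟨r, ρ, hρ0, hsc⟩ := exists_scales (n := n) (ψ := ψ) (Qf := Qf) (M := M) (K := K)
    (N := (L : ℝ) ^ n) (σ := σ) (s := s) (by linarith) hL hs0 hsσ
    (fun r h0 h1 => (hQf r h0 h1).2.2.1)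
    (fun r h0 h1 => hpos _ (hQf r h0 h1).1)
    (fun r u h0 h1 hu hK' => by
      obtain ⟨hQ1, -, -, hQe, -, -⟩ := hQf r h0 h1
      have hQ0 : (0 : ℝ) < Qf r := by exact_mod_cast hQ1
      have hψ0 := hpos _ hQ1
      refine le_of_pow_le_pow_left₀ (by omega : n ≠ 0) hu.le ?_
      refine le_of_mul_le_mul_left (a := (Qf r : ℝ) ^ (n + 1)) ?_ (by positivity)
      calc (Qf r : ℝ) ^ (n + 1) * (ψ (Qf r) / 4) ^ n ≤ (Qf r : ℝ) ^ (n + 1) * ψ (Qf r) ^ n := by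
            gcongr; linarith
        _ ≤ 1 := hQe.trans (pow_le_one₀ he0.le he1)
        _ ≤ K / M ^ n := by rw [hKM]; exact h8A
        _ ≤ _ := hK')
    (fun r u h0 h1 hu hK' => (hQf r h0 h1).2.2.2.2.2 u hu hK')
  have hρpos : ∀ m, 0 < ρ m := fun m => (hsc m).1
  have hρM : ∀ m, ρ (m + 1) ≤ ρ m / M := fun m => (hsc m).2.2.2.1
  have hr0 : ∀ m, 0 < r m := fun m => (hsc m).1.trans_le (hsc m).2.1
  have hr1 : ∀ m, r m ≤ 1 := fun m => (hsc m).2.2.1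
  have hρanti : Antitone ρ := antitone_nat_of_succ_le fun m =>
    (hρM m).trans (div_le_self (hρpos m).le (by linarith))
  have hρlim : Tendsto ρ atTop (𝓝 0) := by
    have h1 : ∀ m, ρ m ≤ (M⁻¹) ^ m := by
      intro m
      induction m with
      | zero => rw [hρ0]; simp
      | succ m ih =>
        refine (hρM m).trans ?_
        rw [pow_succ, div_eq_mul_inv]
        gcongr
    exact squeeze_zero (fun m => (hρpos m).le) h1
      (tendsto_pow_atTop_nhds_zero_of_lt_one (by positivity) (inv_lt_one_of_one_lt₀ (by linarith)))
  have hpowlim : ∀ a : ℝ, Tendsto (fun m => a * ρ m ^ n) atTop (𝓝 0) := by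
    intro a
    have := (hρlim.pow n).const_mul a
    rwa [zero_pow (by omega), mul_zero] at this
  set J : ℕ → Prop := fun m => (Qf (r m) : ℝ) ^ (n + 1) * (ρ m / M) ^ n ≤ K with hJ
  -- Without further jumps the target would stay fixed while `ρ` tends to 0, against the lower bound
  -- `K`.
  have hJinf : ∀ m, ∃ k, m ≤ k ∧ J k := by
    intro m
    by_contra hcon
    push Not at hcon
    have hconst : ∀ k, r (m + k) = r m := by
      intro k
      induction k with
      | zero => rfl
      | succ k ih =>
        have h1 := hcon (m + k) (by omega)
        rw [← ih]
        exact ((hsc (m + k)).2.2.2.2.2.2.2 (not_le.1 h1)).1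
    have h1 := (tendsto_add_atTop_iff_nat m).2 (hpowlim ((Qf (r m) : ℝ) ^ (n + 1)))
    obtain ⟨k, hk⟩ := (h1.eventually (gt_mem_nhds (show (0 : ℝ) < K by linarith))).exists
    have h2 := (hsc (m + k)).2.2.2.2.2.1
    rw [hconst k, add_comm m k] at h2
    linarith
  -- the tree
  let Node : ℕ → (Fin n → ℝ) → Prop := fun m x => GoodCube ψ c c' θ (r m) x (ρ m) ∧
    ∀ k, m = k + 1 → J k → ∃ (p : Fin n → ℤ) (q : ℕ), 1 ≤ q ∧ ∀ w, ‖w - x‖ ≤ ρ m →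
      0 < ‖w - ratPt p q‖ ∧ ‖w - ratPt p q‖ < ψ q ∧ ‖w - ratPt p q‖ ≤ 4 * ρ m
  have : Nonempty (Fin n → Fin L) := ⟨fun _ => ⟨0, hL1⟩⟩
  refine le_dimH_of_tree (D := Fin n → Fin L) (ρ := ρ) (Node := Node) (x₀ := 0) ?_ hs hρ0 hρpos
    hρanti hρlim ?_ ?_ ?_ ?_
  · rw [hcardD]
    exact hL2.trans (Nat.le_self_pow (by omega) L)
  · intro m
    rw [hcardD]
    push_cast
    exact (hsc m).2.2.2.2.1
  -- At radius 1 no denominator is small enough, because `θ ≤ 1`.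
  · refine ⟨?_, fun k hk => by omega⟩
    intro y _ p q hq h
    rw [hρ0, one_pow, mul_one] at h
    have : (1 : ℝ) ≤ (q : ℝ) ^ (n + 1) := one_le_pow₀ (by exact_mod_cast hq)
    linarith
  · rintro m x ⟨hx, -⟩
    obtain ⟨-, -, -, -, -, hKρ, hjump, hstay⟩ := hsc m
    obtain ⟨F, hF1, hF2, hF3⟩ := exists_children hn hL1 hM hθ x (hρpos m)
    rw [← hc] at hF3
    have hh0 : 0 < ρ m / M := div_pos (hρpos m) hM0
    have hFsub : ∀ i, ‖F i - x‖ + ρ m / M ≤ ρ m := fun i => by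
      have := hF1 i; have := hρpos m; linarith
    have hFgood : ∀ i, GoodCube ψ c c' θ (r m) (F i) (ρ m / M) := fun i =>
      hx.child hn hB hc'0 hc'B2 (hFsub i) (fun y hy p q hq h1 h2 => hF3 i y hy p q hq h1 h2)
    have hsep : ∀ G : (Fin n → Fin L) → Fin n → ℝ, (∀ i, ‖G i - F i‖ + ρ (m + 1) ≤ ρ m / M) →
        ∀ i j, i ≠ j → ∀ w w', ‖w - G i‖ ≤ ρ (m + 1) → ‖w' - G j‖ ≤ ρ (m + 1) →
          2 * ρ (m + 1) ≤ ‖w - w'‖ := by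
      intro G hG i j hij w w' hw hw'
      have h1 := hF2 i j hij
      have h2 := hG i
      have h3 := hG j
      have h4 := hρM m
      have h5 : ‖F i - F j‖ ≤ ‖w - w'‖ + (‖w - G i‖ + ‖G i - F i‖) + (‖w' - G j‖ + ‖G j - F j‖) := by
        have e1 := dist_triangle4 (F i) w w' (F j)
        have e2 := dist_triangle w (G i) (F i)
        have e3 := dist_triangle w' (G j) (F j)
        rw [dist_comm (F i) w] at e1
        simp only [dist_eq_norm] at e1 e2 e3
        linarith
      linarith
    have hGx : ∀ G : (Fin n → Fin L) → Fin n → ℝ, (∀ i, ‖G i - F i‖ + ρ (m + 1) ≤ ρ m / M) →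
        ∀ i, ‖G i - x‖ + ρ (m + 1) ≤ ρ m := by
      intro G hG i
      have h1 := dist_triangle (G i) (F i) x
      simp only [dist_eq_norm] at h1
      have := hG i
      have := hFsub i
      linarith
    rcases le_or_gt ((Qf (r m) : ℝ) ^ (n + 1) * (ρ m / M) ^ n) K with hJm | hJm
    · obtain ⟨er, eρ⟩ := hjump hJm
      obtain ⟨hQ1, hQreg, -, hQe, ⟨η, hη0, hη, hQη⟩, -⟩ := hQf (r m) (hr0 m) (hr1 m)
      have hlow : 8 ^ n * A ^ n ≤ (Qf (r m) : ℝ) ^ (n + 1) * (ρ m / M) ^ n := by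
        rw [← hKM, div_pow, ← mul_div_assoc]; gcongr
      -- The cube is subdivided even at a jump and each child jumps separately, so the tree keeps
      -- constant branching.
      have hj := fun i => exists_jump hn hL1 hpos hmono hM hθ hc hA hθ1 hc1 hN1 hd0 hNd he0 he1 hed hB
        hc'0 hc'1 hc'K (hθ1.trans hK1) hc'B hη0 hη hQ1 hQη hQreg hQe hh0 hlow hJm (hFgood i)
      choose G hG1 hG2 hG3 using fun i => (hj i).2
      rw [← eρ] at hG1
      refine ⟨G, fun i => ⟨⟨?_, fun k hk _ => ?_⟩, hGx G hG1 i⟩, hsep G hG1⟩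
      · rw [er, eρ]; exact hG2 i
      · obtain ⟨p, q, hq, hw⟩ := hG3 i
        refine ⟨p, q, hq, fun w hwx => ?_⟩
        rw [eρ] at hwx ⊢
        obtain ⟨h1, h2, h3⟩ := hw w hwx
        exact ⟨h1, h2, by linarith⟩
    · obtain ⟨er, eρ⟩ := hstay hJm
      have hFF : ∀ i, ‖F i - F i‖ + ρ (m + 1) ≤ ρ m / M := fun i => by simp [eρ]
      refine ⟨F, fun i => ⟨⟨?_, fun k hk hJk => ?_⟩, hGx F hFF i⟩, hsep F hFF⟩
      · rw [er, eρ]; exact hFgood i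
      · obtain rfl : m = k := by omega
        exact absurd hJk (not_le.2 hJm)
  · intro w hw
    refine mem_badlyApproximableSet hc'0 ?_ ?_
    · intro p q hq
      obtain ⟨m, hm⟩ := ((hpowlim ((q : ℝ) ^ (n + 1))).eventually (gt_mem_nhds hθ0)).exists
      obtain ⟨x, ⟨hx, -⟩, hwx⟩ := hw m
      exact (hx w hwx p q hq hm).1
    · intro ε hε
      obtain ⟨m, hm⟩ := eventually_atTop.1 (hρlim.eventually (gt_mem_nhds (by positivity : 0 < ε / 4)))
      obtain ⟨k, hk, hJk⟩ := hJinf m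
      obtain ⟨x, ⟨-, hx⟩, hwx⟩ := hw (k + 1)
      obtain ⟨p, q, hq, h⟩ := hx k rfl hJk
      obtain ⟨h1, h2, h3⟩ := h w hwx
      have := hm (k + 1) (by omega)
      exact ⟨p, q, hq, h1, h2, by linarith⟩

theorem mainTheorem3 (n : ℕ) (hn : 1 ≤ n) (ψ : ℕ → ℝ)
    (hpos : ∀ s : ℕ, 1 ≤ s → 0 < ψ s)
    (hmono : AntitoneOn ψ (Set.Ici 1))
    (hlittle : Asymptotics.IsLittleO Filter.atTop ψ
      (fun s : ℕ => (s : ℝ) ^ (-(((n : ℝ) + 1) / (n : ℝ))))) :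
    dimH (badlyApproximableSet n ψ) = dimH (approximableSet n ψ) := by
  refine le_antisymm (dimH_mono sdiff_subset) (le_of_forall_lt fun s hs => ?_)
  -- `s₀` is the dimension reached, `s₁` fixes the exponent of `Q`, and `s₂` gives the strict gap
  -- needed by the covering bound.
  obtain ⟨s₀, hs₀, hs₀W⟩ := ENNReal.lt_iff_exists_nnreal_btwn.1 hs
  obtain ⟨s₁, hs₁, hs₁W⟩ := ENNReal.lt_iff_exists_nnreal_btwn.1 hs₀W
  obtain ⟨s₂, hs₂, hs₂W⟩ := ENNReal.lt_iff_exists_nnreal_btwn.1 hs₁W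
  have h0 : 0 < s₀ := by exact_mod_cast (zero_le).trans_lt hs₀
  have h01 : (s₀ : ℝ) < s₁ := by exact_mod_cast hs₁
  have h12 : (s₁ : ℝ) < s₂ := by exact_mod_cast hs₂
  have hs₁0 : (0 : ℝ) < s₁ := lt_of_le_of_lt s₀.2 h01
  have hW : dimH (approximableSet n ψ) ≤ n := by
    rw [← Real.dimH_univ_pi_fin n]; exact dimH_mono (subset_univ _)
  have hs₁n : (s₁ : ℝ) ≤ n := by
    have h : (s₁ : ℝ≥0∞) ≤ (n : ℝ≥0) := by simpa using hs₁W.le.trans hW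
    exact_mod_cast ENNReal.coe_le_coe.1 h
  refine hs₀.trans_le (le_dimH_badlyApproximableSet hn hpos hmono hlittle h0 h01 hs₁n ?_)
  by_contra hcon
  rw [not_frequently] at hcon
  exact absurd hs₂W (not_lt.2 (dimH_approximableSet_le hs₁0 h12 (hcon.mono fun _ h => not_lt.1 h)))
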